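/- Let $k$ be a field. A numerical semigroup is a submonoid of $\mathbb N$ generated by finitely many positive integers with greatest common divisor $1$. For a set $A=\{a_1,\dots,a_p\}$ of positive integers, let $I_A$ be the kernel of $k[x_1,\dots,x_p]\to k[t]$, $x_i\mapsto t^{a_i}$, where $x_i$ has weight $a_i$, so that $k[A]\cong k[x_1,\dots,x_p]/I_A$ is graded. A minimal DG algebra resolution of a graded quotient $S/I$ of a weighted polynomial ring $S$ is a minimal graded free resolution $F$ of $S/I$ over $S$ (free modules $F_i$ of finite rank, $F_0=S$, homogeneous differential $\partial$ with $\partial(F_i)\subset \mathfrak m F_{i-1}$, $\mathfrak m$ being the ideal generated by the variables), with an $S$-bilinear product on $\bigoplus_i F_i$ that is associative, has unit $1\in F_0$, and satisfies, for $a\in F_i$ and $b\in F_j$, $ab\in F_{i+j}$, $ba=(-1)^{ij}ab$ and $\partial(ab)=\partial(a)\,b+(-1)^i a\,\partial(b)$. Let $A=\{a_1,\dots,a_p\}$ and $B=\{b_1,\dots,b_q\}$ be the minimal generating sets of numerical semigroups $\langle A\rangle$ and $\langle B\rangle$, and let the numerical semigroup $\langle C\rangle$ be obtained by gluing them: its minimal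 generating set is a disjoint union $C=k_1A\sqcup k_2B$, where $k_1,k_2$ are relatively prime positive integers with $k_1\in\langle B\rangle\setminus B$ and $k_2\in\langle A\rangle\setminus A$. Let $R=k[x_1,\dots,x_p,y_1,\dots,y_q]$, where $x_i$ has weight $k_1a_i$ and $y_j$ has weight $k_2b_j$, so that $k[C]\cong R/I_C$. If $k[A]$ and $k[B]$ have minimal DG algebra resolutions over $k[x_1,\dots,x_p]$ and $k[y_1,\dots,y_q]$ respectively, then $k[C]$ has a minimal DG algebra resolution over $R$. More precisely, let $F_A$ and $F_B$ be any minimal DG algebra resolutions of $k[A]$ and $k[B]$. 1. The complex $G=F_A\otimes F_B$ of free $R$-modules (both factors being extended to $R$), with the product $$(a_1\otimes b_1)(a_2\otimes b_2)=(-1)^{\deg b_1\cdot\deg a_2}\,(a_1a_2)\otimes(b_1b_2),$$ is a minimal DG algebra resolution of $R/(I_AR+I_BR)$. 2. Let $\alpha_i,\beta_j$ be any non-negative integers with $\sum_i\alpha_ia_i=k_2$ and $\sum_j\beta_jb_j=k_1$, and let $\rho=\prod_ix_i^{\alpha_i}-\prod_jy_j^{\beta_j}$. The mapping cone of multiplication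 by $\rho$ on $G$, which is $G_i\oplus G_{i-1}$ in degree $i$, with differential $\partial(a,b)=(\partial a+(-1)^{i-1}\rho b,\ \partial b)$ and product $$(a_1,b_1)\star(a_2,b_2)=(a_1a_2,\ a_1b_2+(-1)^jb_1a_2)\qquad\text{for }(a_2,b_2)\in G_j\oplus G_{j-1},$$ is a minimal DG algebra resolution of $k[C]$. -/

import Mathlib

open MvPolynomial

noncomputable section

namespace Gluing

/-! ### Numerical semigroups, their semigroup rings, and gluing -/

/-- The elements of the family `a` are the (pairwise distinct) minimal generators of a numerical
semigroup: the submonoid of `ℕ` that they generate has finite complement, and no `a i` lies in the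
submonoid generated by the other members of the family. -/
structure MinimallyGeneratesNumericalSemigroup {ι : Type*} (a : ι → ℕ) : Prop where
  finite_compl : ((AddSubmonoid.closure (Set.range a) : Set ℕ)ᶜ).Finite
  minimal : ∀ i, a i ∉ AddSubmonoid.closure (a '' {i}ᶜ)

/-- The family `C = k₁ A ⊔ k₂ B`, indexed by the disjoint union of the index types. -/
def gluedFamily {ι κ : Type*} (a : ι → ℕ) (b : κ → ℕ) (k₁ k₂ : ℕ) : ι ⊕ κ → ℕ :=
  Sum.elim (fun i => k₁ * a i) (fun j => k₂ * b j)

/-- The numerical semigroup `⟨C⟩`, `C = k₁ A ⊔ k₂ B`, is obtained by gluing `⟨A⟩` and `⟨B⟩`. -/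
structure IsGluing {ι κ : Type*} (a : ι → ℕ) (b : κ → ℕ) (k₁ k₂ : ℕ) : Prop where
  left : MinimallyGeneratesNumericalSemigroup a
  right : MinimallyGeneratesNumericalSemigroup b
  glued : MinimallyGeneratesNumericalSemigroup (gluedFamily a b k₁ k₂)
  pos₁ : 0 < k₁
  pos₂ : 0 < k₂
  coprime : Nat.Coprime k₁ k₂
  mem₁ : k₁ ∈ AddSubmonoid.closure (Set.range b)
  notMem₁ : k₁ ∉ Set.range b
  mem₂ : k₂ ∈ AddSubmonoid.closure (Set.range a)
  notMem₂ : k₂ ∉ Set.range a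

/-- The ideal `I_A`: the kernel of `k[x_i] → k[t]`, `x_i ↦ t ^ (a i)`.
The semigroup ring `k[A]`, the image of this map, is the quotient by this ideal. -/
def semigroupIdeal (k : Type*) [Field k] {ι : Type*} (a : ι → ℕ) : Ideal (MvPolynomial ι k) :=
  RingHom.ker (aeval (fun i => (Polynomial.X : Polynomial k) ^ a i) :
    MvPolynomial ι k →ₐ[k] Polynomial k)

/-- The binomial `ρ = ∏ x_i ^ α_i - ∏ y_j ^ β_j`. -/
def rho (k : Type*) [Field k] {ι κ : Type*} [Fintype ι] [Fintype κ] (α : ι → ℕ) (β : κ → ℕ) :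
    MvPolynomial (ι ⊕ κ) k :=
  ∏ i, X (Sum.inl i) ^ α i - ∏ j, X (Sum.inr j) ^ β j

/-! ### Graded free complexes with a product -/

/-- The raw data (no axioms) of a graded free `R`-module `F = ⨁ F_i`, given through a homogeneous
basis, with an endomorphism (the differential) and a bilinear product. A basis element `e` lies in
homological degree `hdeg e`, and it has internal degree `wdeg e`, that is, it spans a
copy of `R(-wdeg e)`. The axioms are in `IsMinimalDGResolution`. -/
structure DGData (R : Type*) [CommRing R] where
  basis : Type
  hdeg : basis → ℕ
  wdeg : basis → ℕ
  one : basis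
  d : (basis →₀ R) →ₗ[R] (basis →₀ R)
  mul : (basis →₀ R) →ₗ[R] (basis →₀ R) →ₗ[R] (basis →₀ R)

/-- The free module `F_i` spanned by the basis elements of homological degree `i`. -/
def DGData.piece {R : Type*} [CommRing R] (F : DGData R) (i : ℕ) : Submodule R (F.basis →₀ R) :=
  Finsupp.supported R R (F.hdeg ⁻¹' {i})

/-- `F` is a minimal graded free resolution of `k[x]/I`, where the variable `x_i` has weight `w i`,
with `F_0 = k[x]`, and its product makes it an associative, graded commutative, unital
differential graded algebra with unit `1 ∈ k[x] = F_0`. -/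
structure IsMinimalDGResolution {k : Type*} [Field k] {ι : Type*} (w : ι → ℕ)
    (I : Ideal (MvPolynomial ι k)) (F : DGData (MvPolynomial ι k)) : Prop where
  /-- each `F_i` has finite rank -/
  finite_rank : ∀ i, (F.hdeg ⁻¹' {i}).Finite
  /-- `F_0` is free on the basis element `one`, of internal degree `0` -/
  hdeg_eq_zero_iff : ∀ e, F.hdeg e = 0 ↔ e = F.one
  wdeg_one : F.wdeg F.one = 0
  /-- the differential has homological degree `-1` -/
  d_mem : ∀ i, ∀ x ∈ F.piece (i + 1), F.d x ∈ F.piece i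
  d_zero : ∀ x ∈ F.piece 0, F.d x = 0
  d_d : ∀ x, F.d (F.d x) = 0
  /-- the differential is homogeneous of degree `0` for the internal grading -/
  d_homogeneous : ∀ e e', F.d (Finsupp.single e 1) e' = 0 ∨
    ∃ n, F.wdeg e = n + F.wdeg e' ∧ IsWeightedHomogeneous w (F.d (Finsupp.single e 1) e') n
  /-- exactness of `F_1 → F_0 → k[x]/I → 0` -/
  exact_zero : ∀ r, r ∈ I ↔ ∃ x ∈ F.piece 1, F.d x = Finsupp.single F.one r
  /-- exactness at `F_i` for `i ≥ 1` -/
  exact_succ : ∀ i, ∀ x ∈ F.piece (i + 1), F.d x = 0 → ∃ y ∈ F.piece (i + 2), F.d y = x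
  /-- minimality -/
  minimal : LinearMap.range F.d ≤
    Ideal.span (Set.range (X : ι → MvPolynomial ι k)) • (⊤ : Submodule _ (F.basis →₀ _))
  /-- the product is graded, unital, associative, graded commutative -/
  mul_mem : ∀ i j, ∀ x ∈ F.piece i, ∀ y ∈ F.piece j, F.mul x y ∈ F.piece (i + j)
  one_mul : ∀ x, F.mul (Finsupp.single F.one 1) x = x
  mul_one : ∀ x, F.mul x (Finsupp.single F.one 1) = x
  mul_assoc : ∀ x y z, F.mul (F.mul x y) z = F.mul x (F.mul y z)
  mul_comm : ∀ i j, ∀ x ∈ F.piece i, ∀ y ∈ F.piece j,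
    F.mul y x = (-1 : MvPolynomial ι k) ^ (i * j) • F.mul x y
  /-- the Leibniz rule -/
  leibniz : ∀ i j, ∀ x ∈ F.piece i, ∀ y ∈ F.piece j,
    F.d (F.mul x y) = F.mul (F.d x) y + (-1 : MvPolynomial ι k) ^ i • F.mul x (F.d y)

/-- The semigroup ring `k[A]` has a minimal DG algebra resolution over `k[x]`, where `x_i` has
weight `a i`. -/
def HasMinimalDGResolution (k : Type*) [Field k] {ι : Type*} (a : ι → ℕ) : Prop :=
  ∃ F : DGData (MvPolynomial ι k), IsMinimalDGResolution a (semigroupIdeal k a) F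

/-! ### The tensor product and the mapping cone -/

/-- The bilinear map with prescribed values on pairs of basis elements. -/
def bilinearExtension {R : Type*} [CommRing R] {E : Type*} (f : E → E → (E →₀ R)) :
    (E →₀ R) →ₗ[R] (E →₀ R) →ₗ[R] (E →₀ R) :=
  Finsupp.linearCombination R (fun e => Finsupp.linearCombination R (f e))

/-- The element `u ⊗ v` of `F_A ⊗ F_B`, both base changed to `R = k[x, y]`, in the basis
`e ⊗ e'`: the coordinate of `u ⊗ v` at `(e, e')` is `u_e(x) * v_e'(y)`. -/
def tmul {k : Type*} [Field k] {ι κ : Type*} {E E' : Type*}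
    (u : E →₀ MvPolynomial ι k) (v : E' →₀ MvPolynomial κ k) :
    (E × E') →₀ MvPolynomial (ι ⊕ κ) k :=
  u.sum fun e r => v.sum fun e' s =>
    Finsupp.single (e, e') (rename Sum.inl r * rename Sum.inr s)

/-- The tensor product `F_A ⊗ F_B` over `R = k[x, y]`, with the usual differential and the product
`(a₁ ⊗ b₁)(a₂ ⊗ b₂) = (-1) ^ (deg b₁ * deg a₂) (a₁ a₂) ⊗ (b₁ b₂)`. The variables `x_i` and `y_j`
have the weights `k₁ * a i` and `k₂ * b j`, hence the internal degrees. -/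
def tensorData {k : Type*} [Field k] {ι κ : Type*} (k₁ k₂ : ℕ)
    (FA : DGData (MvPolynomial ι k)) (FB : DGData (MvPolynomial κ k)) :
    DGData (MvPolynomial (ι ⊕ κ) k) where
  basis := FA.basis × FB.basis
  hdeg e := FA.hdeg e.1 + FB.hdeg e.2
  wdeg e := k₁ * FA.wdeg e.1 + k₂ * FB.wdeg e.2
  one := (FA.one, FB.one)
  d := Finsupp.linearCombination _ fun e =>
    tmul (FA.d (Finsupp.single e.1 1)) (Finsupp.single e.2 1) +
      (-1 : MvPolynomial (ι ⊕ κ) k) ^ FA.hdeg e.1 •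
        tmul (Finsupp.single e.1 1) (FB.d (Finsupp.single e.2 1))
  mul := bilinearExtension fun e f =>
    (-1 : MvPolynomial (ι ⊕ κ) k) ^ (FB.hdeg e.2 * FA.hdeg f.1) •
      tmul (FA.mul (Finsupp.single e.1 1) (Finsupp.single f.1 1))
        (FB.mul (Finsupp.single e.2 1) (Finsupp.single f.2 1))

/-- The mapping cone of multiplication by `r` on `G`, where `r` has internal degree `n`. In
homological degree `i` it is `G_i ⊕ G_{i-1}`, with the differential
`∂(a, b) = (∂ a + (-1) ^ (i - 1) r b, ∂ b)`; the product is
`(a₁, b₁) ⋆ (a₂, b₂) = (a₁ a₂, a₁ b₂ + (-1) ^ j b₁ a₂)`, where `(a₂, b₂)` has degree `j`.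
The basis elements `inl e` and `inr e` stand for `(e, 0)` and `(0, e)`. -/
def coneData {R : Type*} [CommRing R] (r : R) (n : ℕ) (G : DGData R) : DGData R where
  basis := G.basis ⊕ G.basis
  hdeg := Sum.elim G.hdeg (fun e => G.hdeg e + 1)
  wdeg := Sum.elim G.wdeg (fun e => G.wdeg e + n)
  one := Sum.inl G.one
  d := Finsupp.linearCombination R <| Sum.elim
    (fun e => Finsupp.mapDomain Sum.inl (G.d (Finsupp.single e 1)))
    (fun e => (-1 : R) ^ G.hdeg e • Finsupp.single (Sum.inl e) r +
      Finsupp.mapDomain Sum.inr (G.d (Finsupp.single e 1)))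
  mul := bilinearExtension fun e f => match e, f with
    | Sum.inl e, Sum.inl f =>
        Finsupp.mapDomain Sum.inl (G.mul (Finsupp.single e 1) (Finsupp.single f 1))
    | Sum.inl e, Sum.inr f =>
        Finsupp.mapDomain Sum.inr (G.mul (Finsupp.single e 1) (Finsupp.single f 1))
    | Sum.inr e, Sum.inl f =>
        (-1 : R) ^ G.hdeg f •
          Finsupp.mapDomain Sum.inr (G.mul (Finsupp.single e 1) (Finsupp.single f 1))
    | Sum.inr _, Sum.inr _ => 0

end Gluing

end

noncomputable section

namespace Gluing

/-! ### Homogeneous pieces and the sign involution -/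

namespace DGData

variable {R : Type*} [CommRing R] (F : DGData R)

/-! Write `J` for the ideal `I_A R + I_B R`. Ideals `I_A` are generated by differences of monomials
of equal weight, because `k[x] → k[t]` sends monomials to basis vectors
(`ker_le_of_monomial_sub_mem`). The same argument shows that `J` is the kernel of `k[x, y] → k[s,
t]`, `x_i ↦ s ^ a_i`, `y_j ↦ t ^ b_j` (`sumIdeal_eq_ker`). Hence `R/J` is a domain, and ρ, whose
image is `s ^ k₂ - t ^ k₁ ≠ 0`, is a nonzerodivisor on it (`mem_sumIdeal_of_rho_mul_mem`). Moreover
`I_C = J + (ρ)`: by coprimality, two monomials of equal weight in `C` differ, modulo `J`, by trading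
copies of `x ^ α` for copies of `y ^ β` (`semigroupIdeal_gluedFamily`).

The two sets of variables are disjoint, so `F_A ⊗ F_B` is, as a vector space, a tensor product over
`k`. There both factors contract onto their homology in degree 0 by `k`-linear homotopies
(`exists_isContraction`), and the Künneth argument makes the tensor product exact in positive
degrees (`tensorData.exact_succ`).

In the mapping cone of ρ on a resolution of `R/J`, the connecting map is, up to sign, multiplication
by ρ on `R/J`. It is injective with cokernel `R/(J + (ρ))`, so the cone resolves `R/I_C`
(`coneData.isMinimalDGResolution`). Its product is that of `G` with an exterior variable `ε`
adjoined, `∂ε = ρ`, where `(a, b)` stands for `a + b ε`; this is why the DG axioms hold. Minimality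
survives since all matrix entries are, up to sign, entries for `F_A` or `F_B`, or ρ itself, which
lies in the maximal ideal.

Signs are organised by the involution `sgn`, which turns degree-dependent formulas into identities
between linear maps. -/

lemma single_mem_piece (e : F.basis) (r : R) : Finsupp.single e r ∈ F.piece (F.hdeg e) :=
  Finsupp.single_mem_supported R r rfl

variable {F} in
lemma mem_piece_iff {i : ℕ} {x : F.basis →₀ R} :
    x ∈ F.piece i ↔ ∀ e, F.hdeg e ≠ i → x e = 0 := by
  rw [piece, Finsupp.mem_supported']
  rfl

lemma piece_induction {P : (F.basis →₀ R) → Prop} (x : F.basis →₀ R)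
    (add : ∀ x y, P x → P y → P (x + y)) (mem : ∀ i, ∀ x ∈ F.piece i, P x) : P x :=
  Finsupp.induction_linear x (mem 0 0 (zero_mem _)) add
    fun e r => mem _ _ (F.single_mem_piece e r)

lemma map_piece_le {M : Type*} [AddCommGroup M] [Module R M] (f : (F.basis →₀ R) →ₗ[R] M)
    (N : Submodule R M) {i : ℕ} (h : ∀ e, F.hdeg e = i → f (Finsupp.single e 1) ∈ N)
    {x : F.basis →₀ R} (hx : x ∈ F.piece i) : f x ∈ N := by
  rw [piece, Finsupp.supported_eq_span_single] at hx
  have : Submodule.span R ((fun e => Finsupp.single e (1 : R)) '' (F.hdeg ⁻¹' {i})) ≤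
      N.comap f := by
    rw [Submodule.span_le]
    rintro _ ⟨e, he, rfl⟩
    exact h e he
  exact this hx

/-- Multiplication by `(-1) ^ i` in homological degree `i`. -/
def sgn : (F.basis →₀ R) →ₗ[R] (F.basis →₀ R) :=
  Finsupp.linearCombination R fun e => Finsupp.single e ((-1) ^ F.hdeg e)

lemma sgn_single (e : F.basis) (r : R) :
    F.sgn (Finsupp.single e r) = (-1 : R) ^ F.hdeg e • Finsupp.single e r := by
  simp [sgn, mul_comm]

variable {F} in
lemma sgn_of_mem {i : ℕ} {x : F.basis →₀ R} (hx : x ∈ F.piece i) :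
    F.sgn x = (-1 : R) ^ i • x := by
  rw [← sub_eq_zero]
  have := F.map_piece_le (F.sgn - (-1 : R) ^ i • LinearMap.id) ⊥ (i := i)
    (fun e he => by simp [sgn_single, he]) hx
  simpa using this

@[simp]
lemma sgn_sgn (x : F.basis →₀ R) : F.sgn (F.sgn x) = x := by
  induction x using Finsupp.induction_linear with
  | zero => simp
  | add x y hx hy => simp [hx, hy]
  | single e r => rw [sgn_single, map_smul, sgn_single, smul_smul, ← mul_pow]; simp

lemma sgn_mem {i : ℕ} {x : F.basis →₀ R} (hx : x ∈ F.piece i) : F.sgn x ∈ F.piece i := by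
  rw [sgn_of_mem hx]
  exact Submodule.smul_mem _ _ hx

end DGData

namespace IsMinimalDGResolution

variable {k : Type*} [Field k] {σ : Type*} {w : σ → ℕ} {I : Ideal (MvPolynomial σ k)}
  {F : DGData (MvPolynomial σ k)}

lemma one_mem (h : IsMinimalDGResolution w I F) (r : MvPolynomial σ k) :
    Finsupp.single F.one r ∈ F.piece 0 := by
  have := F.single_mem_piece F.one r
  rwa [(h.hdeg_eq_zero_iff _).2 rfl] at this

lemma eq_single_of_mem (h : IsMinimalDGResolution w I F) {x : F.basis →₀ MvPolynomial σ k}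
    (hx : x ∈ F.piece 0) : x = Finsupp.single F.one (x F.one) := by
  ext1 e
  by_cases he : e = F.one
  · simp [he]
  · rw [Finsupp.single_eq_of_ne he]
    exact DGData.mem_piece_iff.1 hx e fun h0 => he ((h.hdeg_eq_zero_iff e).1 h0)

/-- The differential changes the parity of the degree. This anticommutation is what makes the
differentials of the cone and of the tensor product square to zero. -/
lemma sgn_d (h : IsMinimalDGResolution w I F) (x : F.basis →₀ MvPolynomial σ k) :
    F.sgn (F.d x) = -F.d (F.sgn x) := by
  induction x using F.piece_induction with
  | add x y hx hy => simp [hx, hy, add_comm]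
  | mem i x hx =>
    rw [DGData.sgn_of_mem hx]
    cases i with
    | zero => simp [h.d_zero x hx]
    | succ i => simp [DGData.sgn_of_mem (h.d_mem i x hx), pow_succ]

lemma sgn_mul (h : IsMinimalDGResolution w I F) (x y : F.basis →₀ MvPolynomial σ k) :
    F.sgn (F.mul x y) = F.mul (F.sgn x) (F.sgn y) := by
  induction x using F.piece_induction with
  | add x x' hx hx' => simp [hx, hx']
  | mem i x hx =>
    induction y using F.piece_induction with
    | add y y' hy hy' => simp [hy, hy']
    | mem j y hy =>
      rw [DGData.sgn_of_mem hx, DGData.sgn_of_mem hy, DGData.sgn_of_mem (h.mul_mem i j x hx y hy)]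
      simp [smul_smul, pow_add, _root_.mul_comm ((-1 : MvPolynomial σ k) ^ i)]

/-- Once the sign is absorbed in `sgn`, both sides of the Leibniz rule are bilinear, so homogeneity
of the factors is no longer needed. -/
lemma d_mul (h : IsMinimalDGResolution w I F) (x y : F.basis →₀ MvPolynomial σ k) :
    F.d (F.mul x y) = F.mul (F.d x) y + F.mul (F.sgn x) (F.d y) := by
  induction x using F.piece_induction with
  | add x x' hx hx' => simp [hx, hx']; abel
  | mem i x hx =>
    induction y using F.piece_induction with
    | add y y' hy hy' => simp [hy, hy']; abel
    | mem j y hy => simp [DGData.sgn_of_mem hx, h.leibniz i j x hx y hy]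

end IsMinimalDGResolution

/-! ### The mapping cone -/

lemma mem_ideal_smul_top_iff {R E : Type*} [CommRing R] {I : Ideal R} {x : E →₀ R} :
    x ∈ I • (⊤ : Submodule R (E →₀ R)) ↔ ∀ e, x e ∈ I := by
  constructor
  · intro hx e
    refine Submodule.smul_induction_on hx (fun r hr n _ => ?_) (fun x y hx hy => ?_)
    · exact I.mul_mem_right _ hr
    · exact I.add_mem hx hy
  · intro hx
    rw [← Finsupp.sum_single x]
    refine Submodule.sum_mem _ fun e _ => ?_
    rw [← Finsupp.smul_single_one]
    exact Submodule.smul_mem_smul (hx e) trivial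

lemma linearCombination_single_one {R E M : Type*} [CommRing R] [AddCommGroup M] [Module R M]
    (f : E → M) (e : E) : Finsupp.linearCombination R f (Finsupp.single e 1) = f e := by
  simp

lemma bilinearExtension_single_single {R E : Type*} [CommRing R] (f : E → E → (E →₀ R))
    (e e' : E) : bilinearExtension f (Finsupp.single e 1) (Finsupp.single e' 1) = f e e' := by
  simp [bilinearExtension]

namespace coneData

variable {R : Type*} [CommRing R] (r : R) (n : ℕ) (G : DGData R)

/-- The basis element `(e, 0)` of the mapping cone. -/
def left (e : G.basis) : (coneData r n G).basis := (Sum.inl e : G.basis ⊕ G.basis)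

/-- The basis element `(0, e)` of the mapping cone. -/
def right (e : G.basis) : (coneData r n G).basis := (Sum.inr e : G.basis ⊕ G.basis)

lemma left_injective : Function.Injective (left r n G) :=
  Sum.inl_injective (α := G.basis) (β := G.basis)

lemma right_injective : Function.Injective (right r n G) :=
  Sum.inr_injective (α := G.basis) (β := G.basis)

lemma left_ne_right (e f : G.basis) : left r n G e ≠ right r n G f :=
  Sum.inl_ne_inr (a := e) (b := f)

/-- The basis of `coneData` is a sum type only after unfolding. Case analysis through `left` and
`right` keeps terms in the form expected by the rewriting lemmas. -/
lemma basis_cases {P : (coneData r n G).basis → Prop} (hl : ∀ e, P (left r n G e))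
    (hr : ∀ e, P (right r n G e)) (e : (coneData r n G).basis) : P e :=
  Sum.casesOn (motive := P) e hl hr

lemma hdeg_left (e : G.basis) : (coneData r n G).hdeg (left r n G e) = G.hdeg e := rfl

lemma hdeg_right (e : G.basis) : (coneData r n G).hdeg (right r n G e) = G.hdeg e + 1 := rfl

lemma wdeg_right (e : G.basis) : (coneData r n G).wdeg (right r n G e) = G.wdeg e + n := rfl

lemma one_eq : (coneData r n G).one = left r n G G.one := rfl

/-- The inclusion `x ↦ (x, 0)` of `G` into the mapping cone. -/
def inl : (G.basis →₀ R) →ₗ[R] ((coneData r n G).basis →₀ R) :=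
  Finsupp.lmapDomain R R (left r n G)

/-- The inclusion `y ↦ (0, y)` of the shift of `G` into the mapping cone. -/
def inr : (G.basis →₀ R) →ₗ[R] ((coneData r n G).basis →₀ R) :=
  Finsupp.lmapDomain R R (right r n G)

lemma inl_single (e : G.basis) (s : R) :
    inl r n G (Finsupp.single e s) = Finsupp.single (left r n G e) s :=
  Finsupp.mapDomain_single

lemma inr_single (e : G.basis) (s : R) :
    inr r n G (Finsupp.single e s) = Finsupp.single (right r n G e) s :=
  Finsupp.mapDomain_single

@[simp]
lemma inl_apply_left (x : G.basis →₀ R) (e : G.basis) : inl r n G x (left r n G e) = x e :=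
  Finsupp.mapDomain_apply (left_injective r n G) x e

@[simp]
lemma inl_apply_right (x : G.basis →₀ R) (e : G.basis) : inl r n G x (right r n G e) = 0 :=
  Finsupp.mapDomain_of_notMem_range x _ (by
    rintro ⟨f, hf⟩
    exact left_ne_right r n G f e hf)

@[simp]
lemma inr_apply_right (x : G.basis →₀ R) (e : G.basis) : inr r n G x (right r n G e) = x e :=
  Finsupp.mapDomain_apply (right_injective r n G) x e

@[simp]
lemma inr_apply_left (x : G.basis →₀ R) (e : G.basis) : inr r n G x (left r n G e) = 0 :=
  Finsupp.mapDomain_of_notMem_range x _ (by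
    rintro ⟨f, hf⟩
    exact left_ne_right r n G e f hf.symm)

lemma exists_eq_add (z : (coneData r n G).basis →₀ R) :
    ∃ x y, z = inl r n G x + inr r n G y := by
  induction z using Finsupp.induction_linear with
  | zero => exact ⟨0, 0, by simp⟩
  | add z z' hz hz' =>
    obtain ⟨x, y, rfl⟩ := hz
    obtain ⟨x', y', rfl⟩ := hz'
    exact ⟨x + x', y + y', by simp only [map_add]; abel⟩
  | single e s =>
    induction e using basis_cases with
    | hl e => exact ⟨Finsupp.single e s, 0, by rw [inl_single, map_zero, add_zero]⟩
    | hr e => exact ⟨0, Finsupp.single e s, by rw [inr_single, map_zero, zero_add]⟩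

lemma inl_add_inr_inj {x x' y y' : G.basis →₀ R} :
    inl r n G x + inr r n G y = inl r n G x' + inr r n G y' ↔ x = x' ∧ y = y' := by
  constructor
  · intro h
    constructor
    · ext1 e
      simpa using DFunLike.congr_fun h (left r n G e)
    · ext1 e
      simpa using DFunLike.congr_fun h (right r n G e)
  · rintro ⟨rfl, rfl⟩
    rfl

lemma add_mem_piece_iff {i : ℕ} {x y : G.basis →₀ R} :
    inl r n G x + inr r n G y ∈ (coneData r n G).piece i ↔
      x ∈ G.piece i ∧ ∀ e, G.hdeg e + 1 ≠ i → y e = 0 := by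
  simp only [DGData.mem_piece_iff]
  constructor
  · intro h
    constructor
    · intro e he
      simpa using h (left r n G e) he
    · intro e he
      simpa using h (right r n G e) he
  · rintro ⟨h₁, h₂⟩ e he
    induction e using basis_cases with
    | hl e => simpa using h₁ e he
    | hr e => simpa using h₂ e he

lemma add_mem_piece_succ_iff {i : ℕ} {x y : G.basis →₀ R} :
    inl r n G x + inr r n G y ∈ (coneData r n G).piece (i + 1) ↔
      x ∈ G.piece (i + 1) ∧ y ∈ G.piece i := by
  rw [add_mem_piece_iff, DGData.mem_piece_iff (x := y)]
  simp

lemma add_mem_piece_zero_iff {x y : G.basis →₀ R} :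
    inl r n G x + inr r n G y ∈ (coneData r n G).piece 0 ↔ x ∈ G.piece 0 ∧ y = 0 := by
  rw [add_mem_piece_iff, Finsupp.ext_iff (f := y)]
  simp

lemma inl_mem {i : ℕ} {x : G.basis →₀ R} (hx : x ∈ G.piece i) :
    inl r n G x ∈ (coneData r n G).piece i := by
  rw [← add_zero (inl r n G x), ← map_zero (inr r n G), add_mem_piece_iff]
  simpa using hx

lemma inr_mem {i : ℕ} {x : G.basis →₀ R} (hx : x ∈ G.piece i) :
    inr r n G x ∈ (coneData r n G).piece (i + 1) := by
  rw [← zero_add (inr r n G x), ← map_zero (inl r n G), add_mem_piece_succ_iff]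
  simpa using hx

/-- The predicate carries the degree because the second summand is shifted by one and the signs in
the DG axioms depend on the degree in the cone. -/
lemma piece_cases {P : ℕ → ((coneData r n G).basis →₀ R) → Prop} {i : ℕ}
    {z : (coneData r n G).basis →₀ R} (hz : z ∈ (coneData r n G).piece i)
    (add : ∀ i x y, P i x → P i y → P i (x + y))
    (left : ∀ i, ∀ x ∈ G.piece i, P i (inl r n G x))
    (right : ∀ i, ∀ x ∈ G.piece i, P (i + 1) (inr r n G x)) : P i z := by
  obtain ⟨x, y, rfl⟩ := exists_eq_add r n G z
  cases i with
  | zero =>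
    rw [add_mem_piece_zero_iff] at hz
    simpa [hz.2] using left 0 x hz.1
  | succ i =>
    rw [add_mem_piece_succ_iff] at hz
    exact add _ _ _ (left _ x hz.1) (right _ y hz.2)

lemma cases {P : ((coneData r n G).basis →₀ R) → Prop}
    (z : (coneData r n G).basis →₀ R)
    (add : ∀ x y, P x → P y → P (x + y))
    (left : ∀ x, P (inl r n G x)) (right : ∀ x, P (inr r n G x)) : P z := by
  obtain ⟨x, y, rfl⟩ := exists_eq_add r n G z
  exact add _ _ (left x) (right y)

lemma d_left (e : G.basis) : (coneData r n G).d (Finsupp.single (left r n G e) 1) =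
    inl r n G (G.d (Finsupp.single e 1)) :=
  linearCombination_single_one (E := G.basis ⊕ G.basis)
    (M := (G.basis ⊕ G.basis) →₀ R) _ _

lemma d_right (e : G.basis) : (coneData r n G).d (Finsupp.single (right r n G e) 1) =
    (-1 : R) ^ G.hdeg e • Finsupp.single (left r n G e) r +
      inr r n G (G.d (Finsupp.single e 1)) :=
  linearCombination_single_one (E := G.basis ⊕ G.basis)
    (M := (G.basis ⊕ G.basis) →₀ R) _ _

lemma d_inl (x : G.basis →₀ R) : (coneData r n G).d (inl r n G x) = inl r n G (G.d x) := by
  induction x using Finsupp.induction_linear with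
  | zero => simp
  | add x y hx hy => simp only [map_add, hx, hy]
  | single e s =>
    rw [inl_single, ← Finsupp.smul_single_one e s, ← Finsupp.smul_single_one _ s]
    simp only [map_smul, d_left]

/-- In degree `i` of the cone the second component lies in `G_{i-1}`, so the sign `(-1) ^ (i - 1)`
is exactly `sgn`. -/
lemma d_inr (x : G.basis →₀ R) :
    (coneData r n G).d (inr r n G x) = inl r n G (r • G.sgn x) + inr r n G (G.d x) := by
  induction x using Finsupp.induction_linear with
  | zero => simp
  | add x y hx hy => simp only [map_add, hx, hy, smul_add]; abel
  | single e s =>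
    rw [inr_single, ← Finsupp.smul_single_one e s, ← Finsupp.smul_single_one _ s]
    simp only [map_smul, d_right, DGData.sgn_single, inl_single]
    rw [smul_comm r s, ← smul_add, smul_comm r, Finsupp.smul_single_one]

lemma left_mul_left (e f : G.basis) :
    (coneData r n G).mul (Finsupp.single (left r n G e) 1) (Finsupp.single (left r n G f) 1) =
      inl r n G (G.mul (Finsupp.single e 1) (Finsupp.single f 1)) :=
  bilinearExtension_single_single (E := G.basis ⊕ G.basis) _ _ _

lemma left_mul_right (e f : G.basis) :
    (coneData r n G).mul (Finsupp.single (left r n G e) 1) (Finsupp.single (right r n G f) 1) =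
      inr r n G (G.mul (Finsupp.single e 1) (Finsupp.single f 1)) :=
  bilinearExtension_single_single (E := G.basis ⊕ G.basis) _ _ _

lemma right_mul_left (e f : G.basis) :
    (coneData r n G).mul (Finsupp.single (right r n G e) 1) (Finsupp.single (left r n G f) 1) =
      (-1 : R) ^ G.hdeg f •
        inr r n G (G.mul (Finsupp.single e 1) (Finsupp.single f 1)) :=
  bilinearExtension_single_single (E := G.basis ⊕ G.basis) _ _ _

lemma right_mul_right (e f : G.basis) :
    (coneData r n G).mul (Finsupp.single (right r n G e) 1) (Finsupp.single (right r n G f) 1) =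
      0 :=
  bilinearExtension_single_single (E := G.basis ⊕ G.basis) _ _ _

lemma bilinear_ext {E M : Type*} [AddCommGroup M] [Module R M]
    {f g : (E →₀ R) →ₗ[R] (E →₀ R) →ₗ[R] M}
    (h : ∀ e e', f (Finsupp.single e 1) (Finsupp.single e' 1) =
      g (Finsupp.single e 1) (Finsupp.single e' 1)) (x y : E →₀ R) : f x y = g x y := by
  have : f = g := by
    ext e e' : 4
    exact h e e'
  rw [this]

lemma inl_mul_inl (x y : G.basis →₀ R) :
    (coneData r n G).mul (inl r n G x) (inl r n G y) = inl r n G (G.mul x y) :=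
  bilinear_ext (f := (coneData r n G).mul.compl₁₂ (inl r n G) (inl r n G))
    (g := G.mul.compr₂ (inl r n G)) (fun e e' => by
      simp only [LinearMap.compl₁₂_apply, LinearMap.compr₂_apply, inl_single]
      exact left_mul_left r n G _ _) x y

lemma inl_mul_inr (x y : G.basis →₀ R) :
    (coneData r n G).mul (inl r n G x) (inr r n G y) = inr r n G (G.mul x y) :=
  bilinear_ext (f := (coneData r n G).mul.compl₁₂ (inl r n G) (inr r n G))
    (g := G.mul.compr₂ (inr r n G)) (fun e e' => by
      simp only [LinearMap.compl₁₂_apply, LinearMap.compr₂_apply, inl_single, inr_single]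
      exact left_mul_right r n G _ _) x y

lemma inr_mul_inl (x y : G.basis →₀ R) :
    (coneData r n G).mul (inr r n G x) (inl r n G y) = inr r n G (G.mul x (G.sgn y)) :=
  bilinear_ext (f := (coneData r n G).mul.compl₁₂ (inr r n G) (inl r n G))
    (g := (G.mul.compl₂ G.sgn).compr₂ (inr r n G)) (fun e e' => by
      simp only [LinearMap.compl₁₂_apply, LinearMap.compr₂_apply, inl_single, inr_single,
        LinearMap.compl₂_apply, DGData.sgn_single, map_smul]
      exact right_mul_left r n G _ _) x y

lemma inr_mul_inr (x y : G.basis →₀ R) :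
    (coneData r n G).mul (inr r n G x) (inr r n G y) = 0 :=
  bilinear_ext (f := (coneData r n G).mul.compl₁₂ (inr r n G) (inr r n G))
    (g := 0) (fun e e' => by
      simp only [LinearMap.compl₁₂_apply, inr_single]
      exact right_mul_right r n G _ _) x y

end coneData

lemma neg_one_pow_smul_self {R M : Type*} [CommRing R] [AddCommGroup M] [Module R M] (i : ℕ)
    (x : M) : (-1 : R) ^ i • (-1 : R) ^ i • x = x := by
  rw [smul_smul, ← mul_pow]
  simp

/-! ### The cone of a nonzerodivisor as a minimal DG algebra resolution. -/

namespace coneData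

variable {k : Type*} [Field k] {σ : Type*} {w : σ → ℕ} {J : Ideal (MvPolynomial σ k)}
  {G : DGData (MvPolynomial σ k)} {r : MvPolynomial σ k} {n : ℕ}

lemma mul_mem (h : IsMinimalDGResolution w J G) {i j : ℕ}
    {x y : (coneData r n G).basis →₀ MvPolynomial σ k} (hx : x ∈ (coneData r n G).piece i)
    (hy : y ∈ (coneData r n G).piece j) :
    (coneData r n G).mul x y ∈ (coneData r n G).piece (i + j) := by
  refine piece_cases r n G hx (P := fun i x => (coneData r n G).mul x y ∈
    (coneData r n G).piece (i + j)) (fun _ _ _ h₁ h₂ => ?_) (fun i x hx => ?_) fun i x hx => ?_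
  · rw [map_add, LinearMap.add_apply]
    exact add_mem h₁ h₂
  · refine piece_cases r n G hy (P := fun j y => (coneData r n G).mul _ y ∈
      (coneData r n G).piece (i + j)) (fun _ _ _ h₁ h₂ => ?_) (fun j y hy => ?_) fun j y hy => ?_
    · rw [map_add]
      exact add_mem h₁ h₂
    · rw [inl_mul_inl]
      exact inl_mem _ _ _ (h.mul_mem i j x hx y hy)
    · rw [inl_mul_inr]
      exact inr_mem _ _ _ (h.mul_mem i j x hx y hy)
  · refine piece_cases r n G hy (P := fun j y => (coneData r n G).mul _ y ∈
      (coneData r n G).piece (i + 1 + j)) (fun _ _ _ h₁ h₂ => ?_) (fun j y hy => ?_)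
      fun j y hy => ?_
    · rw [map_add]
      exact add_mem h₁ h₂
    · rw [inr_mul_inl, add_right_comm]
      exact inr_mem _ _ _ (h.mul_mem i j x hx _ (G.sgn_mem hy))
    · rw [inr_mul_inr]
      exact zero_mem _

/-- Products with at least two factors from the shifted copy vanish on both sides. The one case
where signs must be compared is a shifted factor followed by two unshifted ones, and there
multiplicativity of `sgn` decides. -/
lemma mul_assoc (h : IsMinimalDGResolution w J G)
    (x y z : (coneData r n G).basis →₀ MvPolynomial σ k) :
    (coneData r n G).mul ((coneData r n G).mul x y) z =
      (coneData r n G).mul x ((coneData r n G).mul y z) := by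
  induction x using cases with
  | add x x' hx hx' => simp only [map_add, LinearMap.add_apply, hx, hx']
  | left x =>
    induction y using cases with
    | add y y' hy hy' => simp only [map_add, LinearMap.add_apply, hy, hy']
    | left y =>
      induction z using cases with
      | add z z' hz hz' => simp only [map_add, hz, hz']
      | left z => simp only [inl_mul_inl, h.mul_assoc]
      | right z => simp only [inl_mul_inl, inl_mul_inr, h.mul_assoc]
    | right y =>
      induction z using cases with
      | add z z' hz hz' => simp only [map_add, hz, hz']
      | left z => simp only [inr_mul_inl, inl_mul_inr, h.mul_assoc]
      | right z => simp only [inl_mul_inr, inr_mul_inr, map_zero]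
  | right x =>
    induction y using cases with
    | add y y' hy hy' => simp only [map_add, LinearMap.add_apply, hy, hy']
    | left y =>
      induction z using cases with
      | add z z' hz hz' => simp only [map_add, hz, hz']
      | left z => simp only [inl_mul_inl, inr_mul_inl, h.mul_assoc, h.sgn_mul]
      | right z => simp only [inr_mul_inl, inl_mul_inr, inr_mul_inr]
    | right y =>
      induction z using cases with
      | add z z' hz hz' => simp only [map_add, hz, hz']
      | left z => simp only [inr_mul_inl, inr_mul_inr, map_zero,
          LinearMap.zero_apply]
      | right z => simp only [inr_mul_inr, map_zero, LinearMap.zero_apply]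

lemma mul_comm (h : IsMinimalDGResolution w J G) {i j : ℕ}
    {x y : (coneData r n G).basis →₀ MvPolynomial σ k} (hx : x ∈ (coneData r n G).piece i)
    (hy : y ∈ (coneData r n G).piece j) : (coneData r n G).mul y x =
      (-1 : MvPolynomial σ k) ^ (i * j) • (coneData r n G).mul x y := by
  refine piece_cases r n G hx (P := fun i x => (coneData r n G).mul y x =
    (-1 : MvPolynomial σ k) ^ (i * j) • (coneData r n G).mul x y)
    (fun _ _ _ h₁ h₂ => ?_) (fun i x hx => ?_) fun i x hx => ?_
  · rw [map_add, map_add, LinearMap.add_apply, smul_add, h₁, h₂]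
  · refine piece_cases r n G hy (P := fun j y => (coneData r n G).mul y _ =
      (-1 : MvPolynomial σ k) ^ (i * j) • (coneData r n G).mul _ y)
      (fun _ _ _ h₁ h₂ => ?_) (fun j y hy => ?_) fun j y hy => ?_
    · rw [map_add, map_add, LinearMap.add_apply, smul_add, h₁, h₂]
    · rw [inl_mul_inl, inl_mul_inl, h.mul_comm i j x hx y hy, map_smul]
    · simp only [inr_mul_inl, inl_mul_inr, DGData.sgn_of_mem hx, map_smul,
        h.mul_comm i j x hx y hy, smul_smul, ← pow_add, mul_add_one, add_comm]
  · refine piece_cases r n G hy (P := fun j y => (coneData r n G).mul y _ =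
      (-1 : MvPolynomial σ k) ^ ((i + 1) * j) • (coneData r n G).mul _ y)
      (fun _ _ _ h₁ h₂ => ?_) (fun j y hy => ?_) fun j y hy => ?_
    · rw [map_add, map_add, LinearMap.add_apply, smul_add, h₁, h₂]
    · rw [inr_mul_inl, inl_mul_inr, DGData.sgn_of_mem hy, h.mul_comm i j x hx y hy]
      simp only [map_smul, add_one_mul, pow_add, mul_smul, neg_one_pow_smul_self]
    · rw [inr_mul_inr, inr_mul_inr, smul_zero]

lemma leibniz (h : IsMinimalDGResolution w J G) {i j : ℕ}
    {x y : (coneData r n G).basis →₀ MvPolynomial σ k} (hx : x ∈ (coneData r n G).piece i)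
    (hy : y ∈ (coneData r n G).piece j) : (coneData r n G).d ((coneData r n G).mul x y) =
      (coneData r n G).mul ((coneData r n G).d x) y +
        (-1 : MvPolynomial σ k) ^ i • (coneData r n G).mul x ((coneData r n G).d y) := by
  refine piece_cases r n G hx (P := fun i x => (coneData r n G).d
    ((coneData r n G).mul x y) = (coneData r n G).mul ((coneData r n G).d x) y +
    (-1 : MvPolynomial σ k) ^ i • (coneData r n G).mul x ((coneData r n G).d y))
    (fun _ _ _ h₁ h₂ => ?_) (fun i x hx => ?_) fun i x hx => ?_
  · simp only [map_add, LinearMap.add_apply, smul_add, h₁, h₂]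
    abel
  · refine piece_cases r n G hy (P := fun j y => (coneData r n G).d
      ((coneData r n G).mul _ y) = (coneData r n G).mul ((coneData r n G).d _) y +
      (-1 : MvPolynomial σ k) ^ i • (coneData r n G).mul _ ((coneData r n G).d y))
      (fun _ _ _ h₁ h₂ => ?_) (fun j y hy => ?_) fun j y hy => ?_
    · simp only [map_add, smul_add, h₁, h₂]
      abel
    · simp only [inl_mul_inl, d_inl, h.leibniz i j x hx y hy, map_add, map_smul]
    · simp only [inl_mul_inl, inl_mul_inr, d_inl, d_inr,
        h.leibniz i j x hx y hy, h.sgn_mul, DGData.sgn_of_mem hx, map_add, map_smul, smul_add,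
        LinearMap.smul_apply, smul_smul, _root_.mul_comm r]
      abel
  · refine piece_cases r n G hy (P := fun j y => (coneData r n G).d
      ((coneData r n G).mul _ y) = (coneData r n G).mul ((coneData r n G).d _) y +
      (-1 : MvPolynomial σ k) ^ (i + 1) • (coneData r n G).mul _ ((coneData r n G).d y))
      (fun _ _ _ h₁ h₂ => ?_) (fun j y hy => ?_) fun j y hy => ?_
    · simp only [map_add, smul_add, h₁, h₂]
      abel
    · simp only [inl_mul_inl, inr_mul_inl, d_inl, d_inr,
        h.d_mul x, h.sgn_mul, DGData.sgn_sgn, DGData.sgn_of_mem hx, h.sgn_d, map_add, map_smul,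
        map_neg, pow_succ, LinearMap.add_apply, LinearMap.smul_apply, mul_neg, mul_one, neg_smul,
        smul_neg, neg_neg, add_assoc]
    -- The product of two shifted elements is zero, so the two terms in which ρ appears must cancel:
    -- they are `(-1) ^ i r x y` and `(-1) ^ (i + 1) r x y`, since `sgn` is applied twice to `y`.
    · simp only [inr_mul_inr, inl_mul_inr, inr_mul_inl,
        d_inr, DGData.sgn_of_mem hx, DGData.sgn_sgn, map_add, map_smul, map_zero,
        LinearMap.add_apply, LinearMap.smul_apply, pow_succ, mul_neg, mul_one, neg_mul,
        neg_smul, add_zero, smul_smul, _root_.mul_comm r, add_neg_cancel]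

/-- This is the long exact sequence of the cone done by hand. Regularity of `r` modulo `J` enters
only for exactness in degree 1, where the connecting map acts on `R/J`; homogeneity of `r` gives the
grading, and membership in the maximal ideal gives minimality. -/
theorem isMinimalDGResolution (h : IsMinimalDGResolution w J G)
    (hr : IsWeightedHomogeneous w r n) (hr_mem : r ∈ Ideal.span (Set.range (X : σ → _)))
    (hreg : ∀ f, r * f ∈ J → f ∈ J) :
    IsMinimalDGResolution w (J ⊔ Ideal.span {r}) (coneData r n G) where
  finite_rank i := by
    -- For `i = 0` the subtraction `i - 1` is truncated, which is harmless: only containment in a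
    -- finite set is needed, and no shifted basis element has degree 0.
    refine (((h.finite_rank i).image (left r n G)).union
      ((h.finite_rank (i - 1)).image (right r n G))).subset fun e => ?_
    induction e using basis_cases with
    | hl e => exact fun he => Or.inl ⟨e, he, rfl⟩
    | hr e =>
      refine fun he => Or.inr ⟨e, ?_, rfl⟩
      rw [Set.mem_preimage, hdeg_right, Set.mem_singleton_iff] at he
      simp [← he]
  hdeg_eq_zero_iff e := by
    induction e using basis_cases with
    | hl e =>
      rw [hdeg_left, one_eq, (left_injective r n G).eq_iff,
        h.hdeg_eq_zero_iff]
    | hr e =>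
      rw [hdeg_right, one_eq]
      exact iff_of_false (Nat.succ_ne_zero _) (left_ne_right r n G _ _).symm
  wdeg_one := h.wdeg_one
  d_mem i z hz := by
    obtain ⟨x, y, rfl⟩ := exists_eq_add r n G z
    rw [add_mem_piece_succ_iff] at hz
    rw [map_add, d_inl, d_inr]
    refine add_mem (inl_mem _ _ _ (h.d_mem i x hz.1))
      (add_mem (inl_mem _ _ _ (Submodule.smul_mem _ _ (G.sgn_mem hz.2))) ?_)
    cases i with
    | zero => simp [h.d_zero y hz.2]
    | succ i => exact inr_mem _ _ _ (h.d_mem i y hz.2)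
  d_zero z hz := by
    obtain ⟨x, y, rfl⟩ := exists_eq_add r n G z
    rw [add_mem_piece_zero_iff] at hz
    simp [hz.2, d_inl, h.d_zero x hz.1]
  d_d z := by
    induction z using cases with
    | add x y hx hy => simp [hx, hy]
    | left x => simp [d_inl, h.d_d]
    | right x =>
      simp [d_inl, d_inr, h.d_d, h.sgn_d]
  d_homogeneous e e' := by
    induction e using basis_cases with
    | hl e =>
      rw [d_left]
      induction e' using basis_cases with
      | hl e' =>
        rw [inl_apply_left]
        exact h.d_homogeneous e e'
      | hr e' => exact Or.inl (inl_apply_right _ _ _ _ _)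
    | hr e =>
      rw [d_right, Finsupp.add_apply, Finsupp.smul_apply]
      induction e' using basis_cases with
      | hl e' =>
        rw [inr_apply_left, add_zero]
        by_cases he : e' = e
        · subst he
          refine Or.inr ⟨n, add_comm _ _, ?_⟩
          rw [Finsupp.single_eq_same]
          have : IsWeightedHomogeneous w ((-1 : MvPolynomial σ k) ^ G.hdeg e') 0 := by
            simpa using (isWeightedHomogeneous_C w ((-1 : k) ^ G.hdeg e'))
          simpa using this.mul hr
        · left
          rw [Finsupp.single_eq_of_ne ((left_injective r n G).ne he), smul_zero]
      | hr e' =>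
        rw [inr_apply_right, Finsupp.single_eq_of_ne
          (left_ne_right _ _ _ _ _).symm, smul_zero, zero_add]
        refine (h.d_homogeneous e e').imp_right ?_
        rintro ⟨m, hm, hm'⟩
        exact ⟨m, by rw [wdeg_right, wdeg_right, hm, add_assoc], hm'⟩
  exact_zero f := by
    rw [Submodule.mem_sup]
    constructor
    · rintro ⟨g, hg, _, hf, rfl⟩
      obtain ⟨s, rfl⟩ := Ideal.mem_span_singleton'.1 hf
      obtain ⟨x, hx, hdx⟩ := (h.exact_zero g).1 hg
      refine ⟨inl r n G x + inr r n G (Finsupp.single G.one s),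
        (add_mem_piece_succ_iff _ _ _).2 ⟨hx, h.one_mem s⟩, ?_⟩
      rw [map_add, d_inl, d_inr, DGData.sgn_of_mem (h.one_mem s),
        h.d_zero _ (h.one_mem s), hdx, map_zero, add_zero, ← map_add, one_eq,
        ← inl_single, pow_zero, one_smul, Finsupp.smul_single, ← Finsupp.single_add,
        smul_eq_mul, _root_.mul_comm]
    · rintro ⟨z, hz, hdz⟩
      obtain ⟨x, y, rfl⟩ := exists_eq_add r n G z
      rw [add_mem_piece_succ_iff] at hz
      rw [map_add, d_inl, d_inr, DGData.sgn_of_mem hz.2, h.d_zero y hz.2,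
        map_zero, add_zero, ← map_add, one_eq, ← inl_single, pow_zero,
        one_smul] at hdz
      have hdx := h.eq_single_of_mem (h.d_mem 0 x hz.1)
      refine ⟨G.d x G.one, (h.exact_zero _).2 ⟨x, hz.1, hdx⟩, r * y G.one,
        Ideal.mul_mem_right _ _ (Ideal.mem_span_singleton_self r), ?_⟩
      simpa using DFunLike.congr_fun hdz (left r n G G.one)
  exact_succ i z hz hdz := by
    obtain ⟨x, y, rfl⟩ := exists_eq_add r n G z
    rw [add_mem_piece_succ_iff] at hz
    rw [map_add, d_inl, d_inr, ← add_assoc, ← map_add,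
      ← map_zero (inl r n G), ← add_zero (inl r n G 0),
      ← map_zero (inr r n G), inl_add_inr_inj] at hdz
    obtain ⟨hdx, hdy⟩ := hdz
    -- The second component is a boundary: for `i > 0` by exactness of `G`, and for `i = 0` because
    -- `∂x = -r y` puts `r y` in `J`, whence `y` is in `J` by regularity.
    obtain ⟨y', hy', rfl⟩ : ∃ y' ∈ G.piece (i + 1), G.d y' = y := by
      cases i with
      | zero =>
        have hy := h.eq_single_of_mem hz.2
        rw [DGData.sgn_of_mem hz.2, pow_zero, one_smul] at hdx
        have hJ : -(r * y G.one) ∈ J := by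
          refine (h.exact_zero _).2 ⟨x, hz.1, ?_⟩
          rw [eq_neg_of_add_eq_zero_left hdx, hy]
          simp
        obtain ⟨y', hy', hdy'⟩ := (h.exact_zero _).1 (hreg _ (neg_mem_iff.1 hJ))
        exact ⟨y', hy', hdy'.trans hy.symm⟩
      | succ i => exact h.exact_succ i y hz.2 hdy
    -- Lifting the second component to `y'` contributes `r • G.sgn y'` to the first. What remains of
    -- `x` is a cycle, because `sgn` anticommutes with the differential.
    obtain ⟨x', hx', hdx'⟩ := h.exact_succ i (x - r • G.sgn y')
      (sub_mem hz.1 (Submodule.smul_mem _ _ (G.sgn_mem hy'))) (by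
        rw [h.sgn_d, smul_neg] at hdx
        rw [map_sub, map_smul, sub_eq_add_neg, hdx])
    refine ⟨inl r n G x' + inr r n G y',
      (add_mem_piece_succ_iff _ _ _).2 ⟨hx', hy'⟩, ?_⟩
    rw [map_add, d_inl, d_inr, ← add_assoc, ← map_add, hdx', sub_add_cancel]
  minimal := by
    rintro _ ⟨z, rfl⟩
    have hmin : ∀ x e, G.d x e ∈ Ideal.span (Set.range (X : σ → MvPolynomial σ k)) := fun x e =>
      mem_ideal_smul_top_iff.1 (h.minimal ⟨x, rfl⟩) e
    induction z using cases with
    | add x y hx hy =>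
      rw [map_add]
      exact add_mem hx hy
    | left x =>
      rw [d_inl, mem_ideal_smul_top_iff]
      intro e
      induction e using basis_cases with
      | hl e => simpa using hmin x e
      | hr e => simp
    | right x =>
      rw [d_inr, mem_ideal_smul_top_iff]
      intro e
      induction e using basis_cases with
      | hl e => simpa using Ideal.mul_mem_right _ _ hr_mem
      | hr e => simpa using hmin x e
  one_mul x := by
    rw [one_eq, ← inl_single]
    induction x using cases with
    | add x y hx hy => rw [map_add, hx, hy]
    | left x => rw [inl_mul_inl, h.one_mul]
    | right x => rw [inl_mul_inr, h.one_mul]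
  mul_one x := by
    rw [one_eq, ← inl_single]
    induction x using cases with
    | add x y hx hy => rw [map_add, LinearMap.add_apply, hx, hy]
    | left x => rw [inl_mul_inl, h.mul_one]
    | right x =>
      rw [inr_mul_inl, DGData.sgn_of_mem (h.one_mem 1), pow_zero, one_smul, h.mul_one]
  mul_mem _ _ _ hx _ hy := mul_mem h hx hy
  mul_assoc := mul_assoc h
  mul_comm _ _ _ hx _ hy := mul_comm h hx hy
  leibniz _ _ _ hx _ hy := leibniz h hx hy

end coneData

/-! ### The defining ideals -/

/-- Choose one monomial in each attained weight. This gives a linear map `N` back from `S` such that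
`N (φ f)` replaces every monomial of `f` by its representative. Thus `f ≡ N (φ f)` modulo `K`, and
the right side is 0 when `φ f = 0`. -/
lemma ker_le_of_monomial_sub_mem {k : Type*} [Field k] {σ S M : Type*} [CommRing S] [Algebra k S]
    (φ : MvPolynomial σ k →ₐ[k] S) (B : Module.Basis M k S) (wt : (σ →₀ ℕ) → M)
    (hφ : ∀ m, φ (monomial m 1) = B (wt m)) (K : Ideal (MvPolynomial σ k))
    (hK : ∀ m m', wt m = wt m' → monomial m 1 - monomial m' 1 ∈ K) : RingHom.ker φ ≤ K := by
  classical
  -- The value 0 on weights attained by no monomial is irrelevant, since such basis vectors do not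
  -- occur in the image of `φ`.
  let N : S →ₗ[k] MvPolynomial σ k := B.constr k fun v =>
    if h : ∃ m, wt m = v then monomial h.choose 1 else 0
  have key : ∀ f, f - N (φ f) ∈ K := fun f => by
    induction f using MvPolynomial.induction_on' with
    | monomial m c =>
      have : monomial m c = c • monomial m (1 : k) := by simp [smul_monomial]
      have h : ∃ m', wt m' = wt m := ⟨m, rfl⟩
      rw [this, map_smul, map_smul, ← smul_sub, hφ, Module.Basis.constr_basis, dif_pos h,
        MvPolynomial.smul_eq_C_mul]
      exact K.mul_mem_left _ (hK _ _ h.choose_spec.symm)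
    | add p q hp hq =>
      rw [map_add, map_add, add_sub_add_comm]
      exact K.add_mem hp hq
  intro f hf
  rw [RingHom.mem_ker] at hf
  simpa [hf] using key f

section

variable {k : Type*} [Field k] {ι κ : Type*}

lemma aeval_X_pow_monomial (a : ι → ℕ) (m : ι →₀ ℕ) :
    aeval (fun i => (Polynomial.X : Polynomial k) ^ a i) (monomial m (1 : k)) =
      Polynomial.X ^ Finsupp.linearCombination ℕ a m := by
  rw [aeval_monomial, map_one, one_mul, Finsupp.linearCombination_apply, Finsupp.prod, Finsupp.sum,
    ← Finset.prod_pow_eq_pow_sum]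
  exact Finset.prod_congr rfl fun i _ => by rw [← pow_mul, smul_eq_mul, mul_comm]

lemma aeval_monomial_monomial {τ : Type*} (c : ι → τ →₀ ℕ) (m : ι →₀ ℕ) :
    aeval (fun i => (monomial (c i) 1 : MvPolynomial τ k)) (monomial m (1 : k)) =
      monomial (Finsupp.linearCombination ℕ c m) 1 := by
  rw [aeval_monomial, map_one, one_mul, Finsupp.linearCombination_apply, Finsupp.prod, Finsupp.sum,
    monomial_sum_one]
  exact Finset.prod_congr rfl fun i _ => by rw [monomial_pow, one_pow]

lemma monomial_sub_mem_semigroupIdeal {a : ι → ℕ} {m m' : ι →₀ ℕ}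
    (h : Finsupp.linearCombination ℕ a m = Finsupp.linearCombination ℕ a m') :
    monomial m 1 - monomial m' 1 ∈ semigroupIdeal k a := by
  rw [semigroupIdeal, RingHom.mem_ker, map_sub, aeval_X_pow_monomial, aeval_X_pow_monomial, h,
    sub_self]

lemma semigroupIdeal_le {a : ι → ℕ} {K : Ideal (MvPolynomial ι k)}
    (hK : ∀ m m', Finsupp.linearCombination ℕ a m = Finsupp.linearCombination ℕ a m' →
      monomial m 1 - monomial m' 1 ∈ K) : semigroupIdeal k a ≤ K :=
  ker_le_of_monomial_sub_mem _ (Polynomial.basisMonomials k) _ (fun m => by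
    rw [aeval_X_pow_monomial, Polynomial.coe_basisMonomials, Polynomial.X_pow_eq_monomial]) K hK

/-- The exponent of the monomial `x ^ u * y ^ v`. -/
def sumExponent (u : ι →₀ ℕ) (v : κ →₀ ℕ) : ι ⊕ κ →₀ ℕ :=
  u.mapDomain Sum.inl + v.mapDomain Sum.inr

lemma exists_eq_sumExponent (m : ι ⊕ κ →₀ ℕ) : ∃ u v, m = sumExponent u v := by
  induction m using Finsupp.induction_linear with
  | zero => exact ⟨0, 0, by simp [sumExponent]⟩
  | add m m' hm hm' =>
    obtain ⟨u, v, rfl⟩ := hm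
    obtain ⟨u', v', rfl⟩ := hm'
    exact ⟨u + u', v + v', by simp only [sumExponent, Finsupp.mapDomain_add]; abel⟩
  | single e n =>
    rcases e with i | j
    · exact ⟨Finsupp.single i n, 0, by simp [sumExponent]⟩
    · exact ⟨0, Finsupp.single j n, by simp [sumExponent]⟩

lemma monomial_sumExponent (u : ι →₀ ℕ) (v : κ →₀ ℕ) :
    (monomial (sumExponent u v) 1 : MvPolynomial (ι ⊕ κ) k) =
      rename Sum.inl (monomial u 1) * rename Sum.inr (monomial v 1) := by
  simp [sumExponent, rename_monomial, monomial_mul]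

lemma rename_inl_monomial (u : ι →₀ ℕ) : rename (Sum.inl : ι → ι ⊕ κ) (monomial u (1 : k)) =
    monomial (sumExponent u 0) 1 := by
  simp [sumExponent, rename_monomial]

lemma rename_inr_monomial (v : κ →₀ ℕ) : rename (Sum.inr : κ → ι ⊕ κ) (monomial v (1 : k)) =
    monomial (sumExponent 0 v) 1 := by
  simp [sumExponent, rename_monomial]

lemma monomial_add_smul (m n : ι →₀ ℕ) (c : ℕ) :
    (monomial (m + c • n) (1 : k)) = monomial m 1 * monomial n 1 ^ c := by
  rw [monomial_pow, monomial_mul, one_pow, mul_one]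

lemma linearCombination_sumExponent {M : Type*} [AddCommMonoid M] (c : ι ⊕ κ → M) (u : ι →₀ ℕ)
    (v : κ →₀ ℕ) : Finsupp.linearCombination ℕ c (sumExponent u v) =
      Finsupp.linearCombination ℕ (c ∘ Sum.inl) u +
        Finsupp.linearCombination ℕ (c ∘ Sum.inr) v := by
  rw [sumExponent, map_add, Finsupp.linearCombination_mapDomain,
    Finsupp.linearCombination_mapDomain]

variable (k) in
/-- The ideal `I_A R + I_B R` of `R = k[x, y]`. -/
abbrev sumIdeal (a : ι → ℕ) (b : κ → ℕ) : Ideal (MvPolynomial (ι ⊕ κ) k) :=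
  (semigroupIdeal k a).map (rename Sum.inl) ⊔ (semigroupIdeal k b).map (rename Sum.inr)

lemma rename_monomial_sub_mem_left {a : ι → ℕ} (b : κ → ℕ) {u u' : ι →₀ ℕ}
    (h : Finsupp.linearCombination ℕ a u = Finsupp.linearCombination ℕ a u') :
    rename Sum.inl (monomial u 1) - rename Sum.inl (monomial u' 1) ∈ sumIdeal k a b := by
  rw [← map_sub]
  exact Ideal.mem_sup_left (Ideal.mem_map_of_mem _ (monomial_sub_mem_semigroupIdeal h))

lemma rename_monomial_sub_mem_right (a : ι → ℕ) {b : κ → ℕ} {v v' : κ →₀ ℕ}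
    (h : Finsupp.linearCombination ℕ b v = Finsupp.linearCombination ℕ b v') :
    rename Sum.inr (monomial v 1) - rename Sum.inr (monomial v' 1) ∈ sumIdeal k a b := by
  rw [← map_sub]
  exact Ideal.mem_sup_right (Ideal.mem_map_of_mem _ (monomial_sub_mem_semigroupIdeal h))

variable (k) in
/-- The map `k[x, y] → k[s, t]`, `x_i ↦ s ^ (a i)`, `y_j ↦ t ^ (b j)`. -/
def bigradedMap (a : ι → ℕ) (b : κ → ℕ) : MvPolynomial (ι ⊕ κ) k →ₐ[k] MvPolynomial Bool k :=
  aeval fun c => monomial (Sum.elim (fun i => Finsupp.single true (a i))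
    (fun j => Finsupp.single false (b j)) c) 1

lemma bigradedMap_monomial (a : ι → ℕ) (b : κ → ℕ) (u : ι →₀ ℕ) (v : κ →₀ ℕ) :
    bigradedMap k a b (monomial (sumExponent u v) 1) =
      monomial (Finsupp.single true (Finsupp.linearCombination ℕ a u) +
        Finsupp.single false (Finsupp.linearCombination ℕ b v)) 1 := by
  rw [bigradedMap, aeval_monomial_monomial, linearCombination_sumExponent]
  refine congrArg (fun c => monomial c (1 : k)) (congrArg₂ (· + ·) ?_ ?_)
  · exact (Finsupp.apply_linearCombination ℕ (Finsupp.lsingle true : ℕ →ₗ[ℕ] _) a u).symm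
  · exact (Finsupp.apply_linearCombination ℕ (Finsupp.lsingle false : ℕ →ₗ[ℕ] _) b v).symm

lemma rename_mem_ker_bigradedMap_left {a : ι → ℕ} (b : κ → ℕ) {f : MvPolynomial ι k}
    (hf : f ∈ semigroupIdeal k a) : bigradedMap k a b (rename Sum.inl f) = 0 := by
  suffices semigroupIdeal k a ≤
      RingHom.ker ((bigradedMap k a b).comp (rename Sum.inl)) from this hf
  refine semigroupIdeal_le fun m m' h => ?_
  rw [RingHom.mem_ker, map_sub, AlgHom.comp_apply, AlgHom.comp_apply, rename_inl_monomial,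
    rename_inl_monomial, bigradedMap_monomial, bigradedMap_monomial, h, sub_self]

lemma rename_mem_ker_bigradedMap_right (a : ι → ℕ) {b : κ → ℕ} {f : MvPolynomial κ k}
    (hf : f ∈ semigroupIdeal k b) : bigradedMap k a b (rename Sum.inr f) = 0 := by
  suffices semigroupIdeal k b ≤
      RingHom.ker ((bigradedMap k a b).comp (rename Sum.inr)) from this hf
  refine semigroupIdeal_le fun m m' h => ?_
  rw [RingHom.mem_ker, map_sub, AlgHom.comp_apply, AlgHom.comp_apply, rename_inr_monomial,
    rename_inr_monomial, bigradedMap_monomial, bigradedMap_monomial, h, sub_self]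

/-- Keeping the `A`-weight and the `B`-weight in separate variables embeds `R/(I_A R + I_B R)` in a
polynomial ring, so the ideal is prime. -/
lemma sumIdeal_eq_ker (a : ι → ℕ) (b : κ → ℕ) :
    sumIdeal k a b = RingHom.ker (bigradedMap k a b) := by
  refine le_antisymm (sup_le (Ideal.map_le_iff_le_comap.2 fun f hf => ?_)
    (Ideal.map_le_iff_le_comap.2 fun f hf => ?_)) ?_
  · exact rename_mem_ker_bigradedMap_left b hf
  · exact rename_mem_ker_bigradedMap_right a hf
  · refine ker_le_of_monomial_sub_mem _ (basisMonomials Bool k)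
      (Finsupp.linearCombination ℕ (Sum.elim (fun i => Finsupp.single true (a i))
        (fun j => Finsupp.single false (b j)))) (fun m => by
        rw [bigradedMap, aeval_monomial_monomial, coe_basisMonomials]) _ fun m m' h => ?_
    obtain ⟨u, v, rfl⟩ := exists_eq_sumExponent m
    obtain ⟨u', v', rfl⟩ := exists_eq_sumExponent m'
    -- Equality of the combined weights is passed through the images of the monomials, so that it
    -- can be read off coordinate by coordinate.
    have hb := (bigradedMap_monomial (k := k) a b u v).symm.trans
      ((aeval_monomial_monomial _ _).trans ((congrArg (fun c => monomial c 1) h).trans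
        ((aeval_monomial_monomial _ _).symm.trans (bigradedMap_monomial (k := k) a b u' v'))))
    have hb' := monomial_left_injective (one_ne_zero (α := k)) hb
    have h₁ : Finsupp.linearCombination ℕ a u = Finsupp.linearCombination ℕ a u' := by
      simpa using DFunLike.congr_fun hb' true
    have h₂ : Finsupp.linearCombination ℕ b v = Finsupp.linearCombination ℕ b v' := by
      simpa using DFunLike.congr_fun hb' false
    rw [monomial_sumExponent, monomial_sumExponent]
    have := (sumIdeal k a b).add_mem
      ((sumIdeal k a b).mul_mem_right (rename Sum.inr (monomial v 1))
        (rename_monomial_sub_mem_left b h₁))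
      ((sumIdeal k a b).mul_mem_left (rename Sum.inl (monomial u' 1))
        (rename_monomial_sub_mem_right a h₂))
    convert this using 1
    ring

lemma linearCombination_gluedFamily {a : ι → ℕ} {b : κ → ℕ} {k₁ k₂ : ℕ} (u : ι →₀ ℕ) (v : κ →₀ ℕ) :
    Finsupp.linearCombination ℕ (gluedFamily a b k₁ k₂) (sumExponent u v) =
      k₁ * Finsupp.linearCombination ℕ a u + k₂ * Finsupp.linearCombination ℕ b v := by
  rw [linearCombination_sumExponent]
  congr 1
  · exact (Finsupp.apply_linearCombination ℕ (LinearMap.mulLeft ℕ k₁) a u).symm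
  · exact (Finsupp.apply_linearCombination ℕ (LinearMap.mulLeft ℕ k₂) b v).symm

/-! ### The binomial ρ and the ideal of the gluing. -/

section Finite

variable [Fintype ι] [Fintype κ]

lemma rho_eq (α : ι → ℕ) (β : κ → ℕ) :
    rho k α β = rename Sum.inl (monomial (Finsupp.equivFunOnFinite.symm α) 1) -
      rename Sum.inr (monomial (Finsupp.equivFunOnFinite.symm β) 1) := by
  simp [rho, monomial_eq, Finsupp.prod_fintype]

lemma linearCombination_equivFunOnFinite_symm (a α : ι → ℕ) :
    Finsupp.linearCombination ℕ a (Finsupp.equivFunOnFinite.symm α) = ∑ i, α i * a i := by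
  simp [Finsupp.linearCombination_apply, Finsupp.sum_fintype]

variable {a : ι → ℕ} {b : κ → ℕ} {k₁ k₂ : ℕ} {α : ι → ℕ} {β : κ → ℕ}

/-- The ideal is the kernel of a map to a domain, and ρ is not in it: its two monomials have images
with exponents `k₂ > 0` and 0 in the first variable. -/
lemma mem_sumIdeal_of_rho_mul_mem (hα : ∑ i, α i * a i = k₂) (hk₂ : 0 < k₂)
    {f : MvPolynomial (ι ⊕ κ) k} (hf : rho k α β * f ∈ sumIdeal k a b) : f ∈ sumIdeal k a b := by
  rw [sumIdeal_eq_ker, RingHom.mem_ker, map_mul, mul_eq_zero] at hf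
  rw [sumIdeal_eq_ker, RingHom.mem_ker]
  refine hf.resolve_left fun h => ?_
  rw [rho_eq, map_sub, rename_inl_monomial, rename_inr_monomial, bigradedMap_monomial,
    bigradedMap_monomial, sub_eq_zero] at h
  have := DFunLike.congr_fun (monomial_left_injective (one_ne_zero (α := k)) h) true
  simp [linearCombination_equivFunOnFinite_symm, hα] at this
  omega

/-- Modulo `I_A` one has `x ^ u ≡ x ^ u' (x ^ α) ^ c`, and modulo `I_B` one has `y ^ v' ≡ y ^ v (y ^
β) ^ c`. Modulo ρ the factor `(x ^ α) ^ c` may be exchanged for `(y ^ β) ^ c`, as `p - q` divides `p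
^ c - q ^ c`. -/
lemma rename_pow_sub_mem (u : ι →₀ ℕ) (v : κ →₀ ℕ) (c : ℕ) (hα : ∑ i, α i * a i = k₂)
    (hβ : ∑ j, β j * b j = k₁) {u' : ι →₀ ℕ} {v' : κ →₀ ℕ}
    (hu : Finsupp.linearCombination ℕ a u = Finsupp.linearCombination ℕ a u' + k₂ * c)
    (hv : Finsupp.linearCombination ℕ b v' = Finsupp.linearCombination ℕ b v + k₁ * c) :
    monomial (sumExponent u v) 1 - monomial (sumExponent u' v') 1 ∈
      sumIdeal k a b ⊔ Ideal.span {rho k α β} := by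
  set α' := Finsupp.equivFunOnFinite.symm α
  set β' := Finsupp.equivFunOnFinite.symm β
  have h₁ := rename_monomial_sub_mem_left (k := k) b (a := a) (u := u) (u' := u' + c • α') (by
    rw [hu, map_add, map_smul, linearCombination_equivFunOnFinite_symm, hα, smul_eq_mul,
      mul_comm c])
  have h₂ := rename_monomial_sub_mem_right (k := k) a (b := b) (v := v') (v' := v + c • β') (by
    rw [hv, map_add, map_smul, linearCombination_equivFunOnFinite_symm, hβ, smul_eq_mul,
      mul_comm c])
  have h₃ : rename Sum.inl (monomial α' (1 : k)) ^ c - rename Sum.inr (monomial β' 1) ^ c ∈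
      Ideal.span {rho k α β} := by
    rw [Ideal.mem_span_singleton, rho_eq]
    exact sub_dvd_pow_sub_pow _ _ c
  rw [monomial_add_smul, map_mul, map_pow] at h₁ h₂
  rw [monomial_sumExponent, monomial_sumExponent]
  set x := rename (R := k) (Sum.inl : ι → ι ⊕ κ) (monomial u 1)
  set y := rename (R := k) (Sum.inr : κ → ι ⊕ κ) (monomial v 1)
  set x' := rename (R := k) (Sum.inl : ι → ι ⊕ κ) (monomial u' 1)
  set y' := rename (R := k) (Sum.inr : κ → ι ⊕ κ) (monomial v' 1)
  set p := rename (R := k) (Sum.inl : ι → ι ⊕ κ) (monomial α' 1)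
  set q := rename (R := k) (Sum.inr : κ → ι ⊕ κ) (monomial β' 1)
  have : x * y - x' * y' = (y * (x - x' * p ^ c) - x' * (y' - y * q ^ c)) +
      x' * y * (p ^ c - q ^ c) := by ring
  rw [this]
  exact Submodule.add_mem_sup (sub_mem (Ideal.mul_mem_left _ _ h₁) (Ideal.mul_mem_left _ _ h₂))
    (Ideal.mul_mem_left _ _ h₃)

lemma exists_of_mul_add_mul_eq {k₁ k₂ m n m' n' : ℕ} (h₂ : 0 < k₂) (hk : Nat.Coprime k₁ k₂)
    (hle : m' ≤ m) (h : k₁ * m + k₂ * n = k₁ * m' + k₂ * n') :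
    ∃ c, m = m' + k₂ * c ∧ n' = n + k₁ * c := by
  obtain ⟨d, rfl⟩ := Nat.exists_eq_add_of_le hle
  have hd : k₁ * d + k₂ * n = k₂ * n' := by linarith [mul_add k₁ m' d]
  obtain ⟨c, rfl⟩ : k₂ ∣ d := hk.symm.dvd_of_dvd_mul_left
    ((Nat.dvd_add_left (Dvd.intro n rfl)).1 (hd ▸ Dvd.intro n' rfl))
  refine ⟨c, rfl, ?_⟩
  exact Nat.eq_of_mul_eq_mul_left h₂ (by linarith [mul_left_comm k₁ k₂ c, mul_add k₂ n (k₁ * c)])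

/-- Equal weights mean `k₁ (m - m') = k₂ (n' - n)`, so by coprimality `m - m' = k₂ c` and `n' - n =
k₁ c`. The monomials are then related by trading `c` times with ρ, in the direction given by the
larger `A`-weight. -/
lemma semigroupIdeal_gluedFamily (h₂ : 0 < k₂) (hk : Nat.Coprime k₁ k₂)
    (hα : ∑ i, α i * a i = k₂) (hβ : ∑ j, β j * b j = k₁) :
    semigroupIdeal k (gluedFamily a b k₁ k₂) = sumIdeal k a b ⊔ Ideal.span {rho k α β} := by
  apply le_antisymm
  · refine semigroupIdeal_le fun m m' h => ?_
    obtain ⟨u, v, rfl⟩ := exists_eq_sumExponent m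
    obtain ⟨u', v', rfl⟩ := exists_eq_sumExponent m'
    rw [linearCombination_gluedFamily, linearCombination_gluedFamily] at h
    rcases le_total (Finsupp.linearCombination ℕ a u') (Finsupp.linearCombination ℕ a u)
      with hle | hle
    · obtain ⟨c, hc, hc'⟩ := exists_of_mul_add_mul_eq h₂ hk hle h
      exact rename_pow_sub_mem u v c hα hβ hc hc'
    · obtain ⟨c, hc, hc'⟩ := exists_of_mul_add_mul_eq h₂ hk hle h.symm
      rw [← neg_sub]
      exact neg_mem (rename_pow_sub_mem u' v' c hα hβ hc hc')
  · refine sup_le (sup_le (Ideal.map_le_iff_le_comap.2 ?_) (Ideal.map_le_iff_le_comap.2 ?_)) ?_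
    · refine semigroupIdeal_le fun m m' h => ?_
      rw [Ideal.mem_comap, map_sub, rename_inl_monomial, rename_inl_monomial]
      exact monomial_sub_mem_semigroupIdeal (by
        rw [linearCombination_gluedFamily, linearCombination_gluedFamily, h])
    · refine semigroupIdeal_le fun m m' h => ?_
      rw [Ideal.mem_comap, map_sub, rename_inr_monomial, rename_inr_monomial]
      exact monomial_sub_mem_semigroupIdeal (by
        rw [linearCombination_gluedFamily, linearCombination_gluedFamily, h])
    · rw [Ideal.span_singleton_le_iff_mem, rho_eq, rename_inl_monomial, rename_inr_monomial]
      exact monomial_sub_mem_semigroupIdeal (by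
        rw [linearCombination_gluedFamily, linearCombination_gluedFamily,
          linearCombination_equivFunOnFinite_symm, linearCombination_equivFunOnFinite_symm, hα, hβ,
          map_zero, map_zero, mul_zero, mul_zero, add_zero, zero_add, mul_comm])

lemma isWeightedHomogeneous_rho (hα : ∑ i, α i * a i = k₂) (hβ : ∑ j, β j * b j = k₁) :
    IsWeightedHomogeneous (gluedFamily a b k₁ k₂) (rho k α β) (k₁ * k₂) := by
  have hw : ∀ m n, Finsupp.linearCombination ℕ (gluedFamily a b k₁ k₂) m = n →
      IsWeightedHomogeneous (gluedFamily a b k₁ k₂) (monomial m (1 : k)) n := fun m n h =>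
    isWeightedHomogeneous_monomial _ _ _ h
  rw [rho_eq, rename_inl_monomial, rename_inr_monomial]
  refine (weightedHomogeneousSubmodule k (gluedFamily a b k₁ k₂) (k₁ * k₂)).sub_mem
    (hw _ _ ?_) (hw _ _ ?_)
  · rw [linearCombination_gluedFamily, linearCombination_equivFunOnFinite_symm, hα, map_zero,
      mul_zero, add_zero]
  · rw [linearCombination_gluedFamily, linearCombination_equivFunOnFinite_symm, hβ, map_zero,
      mul_zero, zero_add, mul_comm]

lemma rho_mem (h₁ : 0 < k₁) (h₂ : 0 < k₂) (hα : ∑ i, α i * a i = k₂)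
    (hβ : ∑ j, β j * b j = k₁) :
    rho k α β ∈ Ideal.span (Set.range (X : ι ⊕ κ → MvPolynomial (ι ⊕ κ) k)) := by
  obtain ⟨i, -, hi⟩ := Finset.exists_ne_zero_of_sum_ne_zero (hα.trans_ne h₂.ne')
  obtain ⟨j, -, hj⟩ := Finset.exists_ne_zero_of_sum_ne_zero (hβ.trans_ne h₁.ne')
  refine sub_mem (Ideal.mem_of_dvd _ ?_ (Ideal.subset_span ⟨Sum.inl i, rfl⟩))
    (Ideal.mem_of_dvd _ ?_ (Ideal.subset_span ⟨Sum.inr j, rfl⟩))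
  · exact (dvd_pow_self _ (left_ne_zero_of_mul hi)).trans
      (Finset.dvd_prod_of_mem (fun i => X (Sum.inl i) ^ α i) (Finset.mem_univ i))
  · exact (dvd_pow_self _ (left_ne_zero_of_mul hj)).trans
      (Finset.dvd_prod_of_mem (fun j => X (Sum.inr j) ^ β j) (Finset.mem_univ j))

end Finite

end

/-! ### Contracting homotopies over the base field -/

/-- Over a field the image of `d` has a complement and `d` has a linear section over its image; `g`
is projection followed by the section. -/
lemma exists_generalized_inverse {k V : Type*} [Field k] [AddCommGroup V] [Module k V]
    (d : V →ₗ[k] V) : ∃ g : V →ₗ[k] V, ∀ x, d (g (d x)) = d x := by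
  obtain ⟨t, ht⟩ := d.rangeRestrict.exists_rightInverse_of_surjective
    (LinearMap.range_rangeRestrict d)
  obtain ⟨p, hp⟩ := (LinearMap.range d).subtype.exists_leftInverse_of_injective
    (Submodule.ker_subtype _)
  refine ⟨t ∘ₗ p, fun x => ?_⟩
  have h₁ : p (d x) = d.rangeRestrict x := LinearMap.congr_fun hp (d.rangeRestrict x)
  have h₂ : d.rangeRestrict (t (d.rangeRestrict x)) = d.rangeRestrict x :=
    LinearMap.congr_fun ht (d.rangeRestrict x)
  rw [LinearMap.comp_apply, h₁]
  exact congrArg Subtype.val h₂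

/-- The homotopies are linear over `k` only, but scalars `±1` pass through every additive map. -/
lemma map_neg_one_pow_smul {k R V W : Type*} [Field k] [CommRing R] [AddCommGroup V] [Module k V]
    [Module R V] [AddCommGroup W] [Module k W] [Module R W] (f : V →ₗ[k] W) (i : ℕ) (x : V) :
    f ((-1 : R) ^ i • x) = (-1 : R) ^ i • f x := by
  rcases neg_one_pow_eq_or R i with h | h <;> simp [h]

namespace DGData

lemma mem_piece_induction {R : Type*} [CommRing R] {F : DGData R} {i : ℕ}
    {P : (F.basis →₀ R) → Prop} {x : F.basis →₀ R} (hx : x ∈ F.piece i) (zero : P 0)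
    (add : ∀ x y, P x → P y → P (x + y))
    (single : ∀ e r, F.hdeg e = i → P (Finsupp.single e r)) : P x := by
  rw [← Finsupp.sum_single x]
  refine Finset.sum_induction _ P add zero fun e he => single e _ ?_
  exact (Finsupp.mem_supported R x).1 hx he

/-- The `k`-linear map which on the piece of degree `i` is `g` followed by the projection onto the
piece of degree `i + 1`. -/
def raise {k R : Type*} [Field k] [CommRing R] [Algebra k R] (F : DGData R)
    (g : (F.basis →₀ R) →ₗ[k] (F.basis →₀ R)) : (F.basis →₀ R) →ₗ[k] (F.basis →₀ R) :=
  Finsupp.lsum k fun e =>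
    { toFun := fun r => (g (Finsupp.single e r)).filter (F.hdeg · = F.hdeg e + 1)
      map_add' := fun r s => by rw [Finsupp.single_add, map_add, Finsupp.filter_add]
      map_smul' := fun c r => by
        rw [← Finsupp.smul_single, map_smul, Finsupp.filter_smul, RingHom.id_apply] }

variable {k R : Type*} [Field k] [CommRing R] [Algebra k R] {F : DGData R}
  (g : (F.basis →₀ R) →ₗ[k] (F.basis →₀ R))

lemma raise_apply {i : ℕ} {x : F.basis →₀ R} (hx : x ∈ F.piece i) :
    F.raise g x = (g x).filter (F.hdeg · = i + 1) := by
  refine mem_piece_induction (P := fun x => F.raise g x = (g x).filter (F.hdeg · = i + 1)) hx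
    ?_ (fun x y hx hy => ?_) fun e r he => ?_
  · rw [map_zero, map_zero, Finsupp.filter_zero]
  · rw [map_add, hx, hy, map_add, Finsupp.filter_add]
  · subst he
    simp only [raise, Finsupp.lsum_single]
    rfl

lemma filter_mem (x : F.basis →₀ R) (i : ℕ) : x.filter (F.hdeg · = i) ∈ F.piece i :=
  mem_piece_iff.2 fun _ he => Finsupp.filter_apply_neg _ _ he

lemma raise_mem {i : ℕ} {x : F.basis →₀ R} (hx : x ∈ F.piece i) :
    F.raise g x ∈ F.piece (i + 1) := by
  rw [raise_apply g hx]
  exact filter_mem _ _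

end DGData

namespace IsMinimalDGResolution

variable {k : Type*} [Field k] {σ : Type*} {w : σ → ℕ} {I : Ideal (MvPolynomial σ k)}
  {F : DGData (MvPolynomial σ k)}

lemma d_filter (h : IsMinimalDGResolution w I F) (x : F.basis →₀ MvPolynomial σ k) (i : ℕ) :
    F.d (x.filter (F.hdeg · = i + 1)) = (F.d x).filter (F.hdeg · = i) := by
  induction x using F.piece_induction with
  | add x y hx hy => rw [Finsupp.filter_add, map_add, map_add, Finsupp.filter_add, hx, hy]
  | mem j x hx =>
    have hfilter : ∀ (n m : ℕ) (y : F.basis →₀ MvPolynomial σ k), y ∈ F.piece n →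
        y.filter (F.hdeg · = m) = if n = m then y else 0 := fun n m y hy => by
      split_ifs with hnm
      · subst hnm
        exact Finsupp.filter_eq_self_iff _ _ |>.2 fun e he => by
          by_contra h0
          exact he (DGData.mem_piece_iff.1 hy e h0)
      · refine Finsupp.filter_eq_zero_iff _ _ |>.2 fun e he => ?_
        exact DGData.mem_piece_iff.1 hy e (he ▸ Ne.symm hnm)
    rw [hfilter j (i + 1) x hx]
    cases j with
    | zero => simp [h.d_zero x hx, Finsupp.filter_zero]
    | succ j =>
      rw [hfilter j i _ (h.d_mem j x hx)]
      by_cases hji : j = i <;> simp [hji]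

/-- A generalized inverse need not respect degrees. Keeping only its component of degree `+1`
preserves `d g d = d`, because `d` is homogeneous of degree `-1`. -/
lemma exists_graded_inverse (h : IsMinimalDGResolution w I F) :
    ∃ g : (F.basis →₀ MvPolynomial σ k) →ₗ[k] (F.basis →₀ MvPolynomial σ k),
      (∀ x, F.d (g (F.d x)) = F.d x) ∧ ∀ i, ∀ x ∈ F.piece i, g x ∈ F.piece (i + 1) := by
  obtain ⟨g, hg⟩ := exists_generalized_inverse (F.d.restrictScalars k)
  refine ⟨F.raise g, fun x => ?_, fun i x hx => DGData.raise_mem g hx⟩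
  induction x using F.piece_induction with
  | add x y hx hy => simp only [map_add, hx, hy]
  | mem i x hx =>
    cases i with
    | zero => simp [h.d_zero x hx]
    | succ i =>
      rw [DGData.raise_apply g (h.d_mem i x hx), h.d_filter]
      exact (congrArg (Finsupp.filter (F.hdeg · = i)) (hg x)).trans
        ((Finsupp.filter_eq_self_iff _ _).2 fun e he => by
          by_contra h0
          exact he (DGData.mem_piece_iff.1 (h.d_mem i x hx) e h0))

/-- A contracting homotopy `s` over the base field, and the projection `p` onto a complement of the
image of `F_1` in `F_0`. -/
structure IsContraction (F : DGData (MvPolynomial σ k))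
    (s p : (F.basis →₀ MvPolynomial σ k) →ₗ[k] (F.basis →₀ MvPolynomial σ k)) : Prop where
  d_s_add_s_d : ∀ x, F.d (s x) + s (F.d x) = x - p x
  s_mem : ∀ i, ∀ x ∈ F.piece i, s x ∈ F.piece (i + 1)
  p_succ : ∀ i, ∀ x ∈ F.piece (i + 1), p x = 0
  p_d : ∀ x, p (F.d x) = 0
  d_p : ∀ x, F.d (p x) = 0
  p_zero : ∀ x ∈ F.piece 0, p x ∈ F.piece 0

lemma exists_isContraction (h : IsMinimalDGResolution w I F) : ∃ s p, IsContraction F s p := by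
  obtain ⟨g, hg, hg_mem⟩ := h.exists_graded_inverse
  let D : (F.basis →₀ MvPolynomial σ k) →ₗ[k] (F.basis →₀ MvPolynomial σ k) :=
    F.d.restrictScalars k
  -- This correction of `g` keeps `d s d = d` and gains `s s = 0`, the relation needed for `p` to
  -- vanish in positive degrees.
  let s := g ∘ₗ D ∘ₗ g ∘ₗ (LinearMap.id - g ∘ₗ D)
  have hs : ∀ x, s x = g (F.d (g (x - g (F.d x)))) := fun _ => rfl
  have hss : ∀ x, s (s x) = 0 := fun x => by
    rw [hs (s x), hs x, hg, sub_self]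
    simp
  have hds : ∀ x, F.d (s (F.d x)) = F.d x := fun x => by
    rw [hs, h.d_d, map_zero, sub_zero, hg, hg]
  have hsd : ∀ x, s (F.d (s x)) = s x := fun x => by
    have : F.d (s x) = F.d (g (x - g (F.d x))) := by rw [hs x, hg]
    rw [this, hs, h.d_d, map_zero, sub_zero, hg, ← hs]
  have hs_mem : ∀ i, ∀ x ∈ F.piece i, s x ∈ F.piece (i + 1) := fun i x hx => by
    have hgd : g (F.d x) ∈ F.piece i := by
      cases i with
      | zero => simp [h.d_zero x hx]
      | succ i => exact hg_mem i _ (h.d_mem i x hx)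
    exact hg_mem _ _ (h.d_mem _ _ (hg_mem _ _ (sub_mem hx hgd)))
  refine ⟨s, LinearMap.id - D ∘ₗ s - s ∘ₗ D, ?_, hs_mem, ?_, ?_, ?_, ?_⟩
  · intro x
    change F.d (s x) + s (F.d x) = x - (x - F.d (s x) - s (F.d x))
    abel
  · intro i x hx
    -- The element `x - s d x` is a cycle in positive degree, hence a boundary, and `d s` fixes
    -- boundaries. With `s s = 0` this reads `d s x = x - s d x`, that is, `p x = 0`.
    have hz : x - s (F.d x) ∈ F.piece (i + 1) := sub_mem hx (hs_mem i _ (h.d_mem i x hx))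
    obtain ⟨y, -, hy⟩ := h.exact_succ i _ hz (by rw [map_sub, hds, sub_self])
    change x - F.d (s x) - s (F.d x) = 0
    have h₁ : F.d (s (F.d y)) = F.d y := hds y
    rw [hy, map_sub, map_sub, hss, map_zero, sub_zero] at h₁
    rw [h₁]
    abel
  · intro x
    change F.d x - F.d (s (F.d x)) - s (F.d (F.d x)) = 0
    rw [hds, h.d_d, map_zero, sub_self, sub_zero]
  · intro x
    change F.d (x - F.d (s x) - s (F.d x)) = 0
    rw [map_sub, map_sub, h.d_d, hds, sub_zero, sub_self]
  · intro x hx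
    change x - F.d (s x) - s (F.d x) ∈ F.piece 0
    rw [h.d_zero x hx, map_zero, sub_zero]
    exact sub_mem hx (h.d_mem 0 _ (hs_mem 0 x hx))

namespace IsContraction

variable {s p : (F.basis →₀ MvPolynomial σ k) →ₗ[k] (F.basis →₀ MvPolynomial σ k)}

/-- Like `d`, the homotopy changes parity; the map `p` lives in degree 0 and so is insensitive to
signs on either side. -/
lemma sgn_s (hc : IsContraction F s p) (x : F.basis →₀ MvPolynomial σ k) :
    F.sgn (s x) = -s (F.sgn x) := by
  induction x using F.piece_induction with
  | add x y hx hy => simp only [map_add, hx, hy, neg_add]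
  | mem i x hx =>
    rw [DGData.sgn_of_mem hx, DGData.sgn_of_mem (hc.s_mem i x hx), map_neg_one_pow_smul, pow_succ]
    simp

lemma sgn_p (hc : IsContraction F s p) (x : F.basis →₀ MvPolynomial σ k) :
    F.sgn (p x) = p x := by
  induction x using F.piece_induction with
  | add x y hx hy => simp only [map_add, hx, hy]
  | mem i x hx =>
    cases i with
    | zero => simp [DGData.sgn_of_mem (hc.p_zero x hx)]
    | succ i => simp [hc.p_succ i x hx]

lemma p_sgn (hc : IsContraction F s p) (x : F.basis →₀ MvPolynomial σ k) :
    p (F.sgn x) = p x := by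
  induction x using F.piece_induction with
  | add x y hx hy => simp only [map_add, hx, hy]
  | mem i x hx =>
    cases i with
    | zero => simp [DGData.sgn_of_mem hx]
    | succ i => rw [hc.p_succ i x hx, hc.p_succ i _ (F.sgn_mem hx)]

end IsContraction

end IsMinimalDGResolution

/-! ### The tensor product -/

section

open TensorProduct

variable {k : Type*} [Field k] {ι κ : Type*}

lemma tensorEquivSum_tmul (p : MvPolynomial ι k) (q : MvPolynomial κ k) :
    tensorEquivSum k ι κ k (p ⊗ₜ q) = rename Sum.inl p * rename Sum.inr q := by
  have h₁ : ((tensorEquivSum k ι κ k).toAlgHom.comp Algebra.TensorProduct.includeLeft) =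
      rename Sum.inl := by
    ext i
    simp
  have h₂ : ((tensorEquivSum k ι κ k).toAlgHom.comp Algebra.TensorProduct.includeRight) =
      rename Sum.inr := by
    ext i
    simp
  have h₁' := AlgHom.congr_fun h₁ p
  have h₂' := AlgHom.congr_fun h₂ q
  have hpq : p ⊗ₜ[k] q = (p ⊗ₜ 1) * (1 ⊗ₜ q) := by simp
  rw [hpq, map_mul]
  exact congrArg₂ (· * ·) h₁' h₂'

variable (k ι κ) in
/-- The isomorphism over `k` of `F_A ⊗ F_B` over `k` with the tensor product over `R` of the base
changes. -/
def tmulEquiv (E E' : Type*) : (E →₀ MvPolynomial ι k) ⊗[k] (E' →₀ MvPolynomial κ k) ≃ₗ[k]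
    (E × E' →₀ MvPolynomial (ι ⊕ κ) k) :=
  finsuppTensorFinsupp k k (MvPolynomial ι k) (MvPolynomial κ k) E E' ≪≫ₗ
    Finsupp.mapRange.linearEquiv (tensorEquivSum k ι κ k).toLinearEquiv

lemma tmulEquiv_single {E E' : Type*} (e : E) (e' : E') (r : MvPolynomial ι k)
    (s : MvPolynomial κ k) :
    tmulEquiv k ι κ E E' (Finsupp.single e r ⊗ₜ Finsupp.single e' s) =
      Finsupp.single (e, e') (rename Sum.inl r * rename Sum.inr s) := by
  simp [tmulEquiv, tensorEquivSum_tmul]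

lemma tmulEquiv_tmul {E E' : Type*} (u : E →₀ MvPolynomial ι k) (v : E' →₀ MvPolynomial κ k) :
    tmulEquiv k ι κ E E' (u ⊗ₜ v) = tmul u v := by
  conv_lhs => rw [← Finsupp.sum_single u, ← Finsupp.sum_single v]
  simp only [Finsupp.sum, sum_tmul, tmul_sum, map_sum, tmulEquiv_single, tmul]
  exact Finset.sum_comm

end

namespace tensorData

variable {k : Type*} [Field k] {ι κ : Type*} (k₁ k₂ : ℕ) (FA : DGData (MvPolynomial ι k))
  (FB : DGData (MvPolynomial κ k))

/-- The basis element `e ⊗ e'`. -/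
def pair (e : FA.basis) (e' : FB.basis) : (tensorData k₁ k₂ FA FB).basis :=
  ((e, e') : FA.basis × FB.basis)

lemma basis_cases {P : (tensorData k₁ k₂ FA FB).basis → Prop}
    (h : ∀ e e', P (pair k₁ k₂ FA FB e e')) (e : (tensorData k₁ k₂ FA FB).basis) : P e :=
  Prod.casesOn (motive := P) e h

lemma pair_inj {e f : FA.basis} {e' f' : FB.basis} :
    pair k₁ k₂ FA FB e e' = pair k₁ k₂ FA FB f f' ↔ e = f ∧ e' = f' :=
  Prod.mk_inj (a₁ := e) (a₂ := f) (b₁ := e') (b₂ := f')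

lemma hdeg_pair (e : FA.basis) (e' : FB.basis) :
    (tensorData k₁ k₂ FA FB).hdeg (pair k₁ k₂ FA FB e e') = FA.hdeg e + FB.hdeg e' := rfl

lemma wdeg_pair (e : FA.basis) (e' : FB.basis) :
    (tensorData k₁ k₂ FA FB).wdeg (pair k₁ k₂ FA FB e e') = k₁ * FA.wdeg e + k₂ * FB.wdeg e' :=
  rfl

lemma one_eq : (tensorData k₁ k₂ FA FB).one = pair k₁ k₂ FA FB FA.one FB.one := rfl

/-- `F_A ⊗ F_B` over `k` is isomorphic over `k` to the module underlying `tensorData`. -/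
def equiv : TensorProduct k (FA.basis →₀ MvPolynomial ι k) (FB.basis →₀ MvPolynomial κ k) ≃ₗ[k]
    ((tensorData k₁ k₂ FA FB).basis →₀ MvPolynomial (ι ⊕ κ) k) :=
  tmulEquiv k ι κ FA.basis FB.basis

/-- The element `u ⊗ v` of the tensor product. -/
def tm : (FA.basis →₀ MvPolynomial ι k) →ₗ[k] (FB.basis →₀ MvPolynomial κ k) →ₗ[k]
    ((tensorData k₁ k₂ FA FB).basis →₀ MvPolynomial (ι ⊕ κ) k) :=
  (TensorProduct.mk k _ _).compr₂ (equiv k₁ k₂ FA FB).toLinearMap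

lemma tm_eq_tmul (u : FA.basis →₀ MvPolynomial ι k) (v : FB.basis →₀ MvPolynomial κ k) :
    tm k₁ k₂ FA FB u v = tmul u v :=
  tmulEquiv_tmul u v

lemma tm_single (e : FA.basis) (e' : FB.basis) (r : MvPolynomial ι k) (s : MvPolynomial κ k) :
    tm k₁ k₂ FA FB (Finsupp.single e r) (Finsupp.single e' s) =
      Finsupp.single (pair k₁ k₂ FA FB e e') (rename Sum.inl r * rename Sum.inr s) :=
  tmulEquiv_single e e' r s

variable {FA FB}

lemma tm_apply (u : FA.basis →₀ MvPolynomial ι k) (v : FB.basis →₀ MvPolynomial κ k)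
    (e : FA.basis) (e' : FB.basis) : tm k₁ k₂ FA FB u v (pair k₁ k₂ FA FB e e') =
      rename Sum.inl (u e) * rename Sum.inr (v e') := by
  classical
  induction u using Finsupp.induction_linear with
  | zero => simp
  | add u u' hu hu' => simp [hu, hu', add_mul]
  | single f r =>
    induction v using Finsupp.induction_linear with
    | zero => simp
    | add v v' hv hv' => simp only [map_add, Finsupp.add_apply, hv, hv', mul_add]
    | single f' s =>
      rw [tm_single, Finsupp.single_apply, Finsupp.single_apply, Finsupp.single_apply, pair_inj]
      by_cases h₁ : f = e <;> by_cases h₂ : f' = e' <;> simp [h₁, h₂]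

lemma tm_smul_left (c : MvPolynomial ι k) (u : FA.basis →₀ MvPolynomial ι k)
    (v : FB.basis →₀ MvPolynomial κ k) :
    tm k₁ k₂ FA FB (c • u) v =
      (rename Sum.inl c : MvPolynomial (ι ⊕ κ) k) • tm k₁ k₂ FA FB u v := by
  ext1 e
  induction e using basis_cases with
  | h e e' =>
    rw [tm_apply, Finsupp.smul_apply, Finsupp.smul_apply, tm_apply, smul_eq_mul, smul_eq_mul,
      map_mul, mul_assoc]

lemma tm_smul_right (c : MvPolynomial κ k) (u : FA.basis →₀ MvPolynomial ι k)
    (v : FB.basis →₀ MvPolynomial κ k) :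
    tm k₁ k₂ FA FB u (c • v) =
      (rename Sum.inr c : MvPolynomial (ι ⊕ κ) k) • tm k₁ k₂ FA FB u v := by
  ext1 e
  induction e using basis_cases with
  | h e e' =>
    rw [tm_apply, Finsupp.smul_apply, Finsupp.smul_apply, tm_apply, smul_eq_mul, smul_eq_mul,
      map_mul, mul_left_comm]

lemma tm_sign_left (i : ℕ) (u : FA.basis →₀ MvPolynomial ι k)
    (v : FB.basis →₀ MvPolynomial κ k) : tm k₁ k₂ FA FB ((-1 : MvPolynomial ι k) ^ i • u) v =
      (-1 : MvPolynomial (ι ⊕ κ) k) ^ i • tm k₁ k₂ FA FB u v := by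
  rw [tm_smul_left, map_pow, map_neg, map_one]

lemma tm_sign_right (i : ℕ) (u : FA.basis →₀ MvPolynomial ι k)
    (v : FB.basis →₀ MvPolynomial κ k) : tm k₁ k₂ FA FB u ((-1 : MvPolynomial κ k) ^ i • v) =
      (-1 : MvPolynomial (ι ⊕ κ) k) ^ i • tm k₁ k₂ FA FB u v := by
  rw [tm_smul_right, map_pow, map_neg, map_one]

lemma tm_mem {i j : ℕ} {u : FA.basis →₀ MvPolynomial ι k} {v : FB.basis →₀ MvPolynomial κ k}
    (hu : u ∈ FA.piece i) (hv : v ∈ FB.piece j) :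
    tm k₁ k₂ FA FB u v ∈ (tensorData k₁ k₂ FA FB).piece (i + j) := by
  rw [DGData.mem_piece_iff] at hu hv ⊢
  intro e
  induction e using basis_cases with
  | h e e' =>
    rw [hdeg_pair, tm_apply]
    intro h
    by_cases he : FA.hdeg e = i
    · rw [hv e' (by omega), map_zero, mul_zero]
    · rw [hu e he, map_zero, zero_mul]

lemma induction {P : ((tensorData k₁ k₂ FA FB).basis →₀ MvPolynomial (ι ⊕ κ) k) → Prop}
    (x : (tensorData k₁ k₂ FA FB).basis →₀ MvPolynomial (ι ⊕ κ) k)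
    (add : ∀ x y, P x → P y → P (x + y)) (tm : ∀ u v, P (tm k₁ k₂ FA FB u v)) : P x := by
  obtain ⟨t, rfl⟩ := (equiv k₁ k₂ FA FB).surjective x
  induction t using TensorProduct.induction_on with
  | zero => simpa using tm 0 0
  | tmul u v => exact tm u v
  | add x y hx hy =>
    rw [map_add]
    exact add _ _ hx hy

/-- Every monomial of `k[x, y]` is a monomial in `x` times a monomial in `y`, so sums of tensors of
homogeneous elements exhaust each piece. -/
lemma piece_induction {P : ((tensorData k₁ k₂ FA FB).basis →₀ MvPolynomial (ι ⊕ κ) k) → Prop}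
    {n : ℕ} {x : (tensorData k₁ k₂ FA FB).basis →₀ MvPolynomial (ι ⊕ κ) k}
    (hx : x ∈ (tensorData k₁ k₂ FA FB).piece n) (add : ∀ x y, P x → P y → P (x + y))
    (tm : ∀ i j, i + j = n → ∀ u ∈ FA.piece i, ∀ v ∈ FB.piece j, P (tm k₁ k₂ FA FB u v)) :
    P x := by
  refine DGData.mem_piece_induction hx ?_ add fun e r he => ?_
  · simpa using tm 0 n (zero_add n) 0 (zero_mem _) 0 (zero_mem _)
  · induction e using basis_cases with
    | h e e' =>
      induction r using MvPolynomial.induction_on' with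
      | monomial m c =>
        obtain ⟨u, v, rfl⟩ := exists_eq_sumExponent m
        have := tm _ _ he _ (FA.single_mem_piece e (monomial u c)) _
          (FB.single_mem_piece e' (monomial v 1))
        rw [tm_single] at this
        simpa [sumExponent, rename_monomial, monomial_mul] using this
      | add p q hp hq =>
        rw [Finsupp.single_add]
        exact add _ _ hp hq

lemma d_pair (e : FA.basis) (e' : FB.basis) :
    (tensorData k₁ k₂ FA FB).d (Finsupp.single (pair k₁ k₂ FA FB e e') 1) =
      tm k₁ k₂ FA FB (FA.d (Finsupp.single e 1)) (Finsupp.single e' 1) +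
        (-1 : MvPolynomial (ι ⊕ κ) k) ^ FA.hdeg e •
          tm k₁ k₂ FA FB (Finsupp.single e 1) (FB.d (Finsupp.single e' 1)) := by
  rw [tm_eq_tmul, tm_eq_tmul]
  exact linearCombination_single_one (E := FA.basis × FB.basis)
    (M := FA.basis × FB.basis →₀ MvPolynomial (ι ⊕ κ) k) _ _

lemma mul_pair (e f : FA.basis) (e' f' : FB.basis) :
    (tensorData k₁ k₂ FA FB).mul (Finsupp.single (pair k₁ k₂ FA FB e e') 1)
        (Finsupp.single (pair k₁ k₂ FA FB f f') 1) =
      (-1 : MvPolynomial (ι ⊕ κ) k) ^ (FB.hdeg e' * FA.hdeg f) •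
        tm k₁ k₂ FA FB (FA.mul (Finsupp.single e 1) (Finsupp.single f 1))
          (FB.mul (Finsupp.single e' 1) (Finsupp.single f' 1)) := by
  rw [tm_eq_tmul]
  exact bilinearExtension_single_single (E := FA.basis × FB.basis) _ _ _

lemma tm_single_eq_smul (e : FA.basis) (e' : FB.basis) (r : MvPolynomial ι k)
    (s : MvPolynomial κ k) : tm k₁ k₂ FA FB (Finsupp.single e r) (Finsupp.single e' s) =
      (rename Sum.inl r * rename Sum.inr s) • Finsupp.single (pair k₁ k₂ FA FB e e') 1 := by
  rw [tm_single, Finsupp.smul_single_one]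

lemma d_tm (u : FA.basis →₀ MvPolynomial ι k) (v : FB.basis →₀ MvPolynomial κ k) :
    (tensorData k₁ k₂ FA FB).d (tm k₁ k₂ FA FB u v) =
      tm k₁ k₂ FA FB (FA.d u) v + tm k₁ k₂ FA FB (FA.sgn u) (FB.d v) := by
  induction u using Finsupp.induction_linear with
  | zero => simp
  | add u u' hu hu' => simp only [map_add, LinearMap.add_apply, hu, hu']; abel
  | single e r =>
    induction v using Finsupp.induction_linear with
    | zero => simp
    | add v v' hv hv' => simp only [map_add, hv, hv']; abel
    | single e' s =>
      rw [tm_single_eq_smul, map_smul, d_pair, DGData.sgn_single, tm_sign_left,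
        ← Finsupp.smul_single_one e r, ← Finsupp.smul_single_one e' s]
      simp only [LinearMap.map_smul, tm_smul_left, tm_smul_right, smul_add, smul_smul]
      congr 2 <;> ring

/-- Only the two inner factors are interchanged, so only they need to be homogeneous. -/
lemma mul_tm {i j : ℕ} (u : FA.basis →₀ MvPolynomial ι k) {v : FB.basis →₀ MvPolynomial κ k}
    (hv : v ∈ FB.piece j) {u' : FA.basis →₀ MvPolynomial ι k} (hu' : u' ∈ FA.piece i)
    (v' : FB.basis →₀ MvPolynomial κ k) :
    (tensorData k₁ k₂ FA FB).mul (tm k₁ k₂ FA FB u v) (tm k₁ k₂ FA FB u' v') =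
      (-1 : MvPolynomial (ι ⊕ κ) k) ^ (j * i) •
        tm k₁ k₂ FA FB (FA.mul u u') (FB.mul v v') := by
  refine DGData.mem_piece_induction (P := fun v => (tensorData k₁ k₂ FA FB).mul
    (tm k₁ k₂ FA FB u v) _ = _ • tm k₁ k₂ FA FB _ (FB.mul v v')) hv (by simp)
    (fun v w hv hw => ?_) fun e' s he' => ?_
  · simp only [map_add, LinearMap.add_apply, smul_add, hv, hw]
  refine DGData.mem_piece_induction (P := fun u' => (tensorData k₁ k₂ FA FB).mul _
    (tm k₁ k₂ FA FB u' v') = _ • tm k₁ k₂ FA FB (FA.mul u u') _) hu' (by simp)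
    (fun u' w hu' hw => ?_) fun f r' hf => ?_
  · simp only [map_add, LinearMap.add_apply, smul_add, hu', hw]
  subst he' hf
  induction u using Finsupp.induction_linear with
  | zero => simp
  | add u u' hu hu' => simp only [map_add, LinearMap.add_apply, smul_add, hu, hu']
  | single e r =>
    induction v' using Finsupp.induction_linear with
    | zero => simp
    | add v v' hv hv' => simp only [map_add, smul_add, hv, hv']
    | single f' s' =>
      rw [tm_single_eq_smul, tm_single_eq_smul, map_smul, map_smul, LinearMap.smul_apply, mul_pair,
        ← Finsupp.smul_single_one e r, ← Finsupp.smul_single_one e' s,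
        ← Finsupp.smul_single_one f r', ← Finsupp.smul_single_one f' s']
      simp only [LinearMap.map_smul, LinearMap.smul_apply, tm_smul_left, tm_smul_right, smul_smul,
        map_mul]
      congr 1
      ring

end tensorData

lemma IsMinimalDGResolution.d_single_self {k : Type*} [Field k] {σ : Type*} {w : σ → ℕ}
    {I : Ideal (MvPolynomial σ k)} {F : DGData (MvPolynomial σ k)}
    (h : IsMinimalDGResolution w I F) (e : F.basis) : F.d (Finsupp.single e 1) e = 0 := by
  have he := F.single_mem_piece e 1
  generalize hi : F.hdeg e = i at he
  cases i with
  | zero => rw [h.d_zero _ he, Finsupp.zero_apply]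
  | succ i => exact DGData.mem_piece_iff.1 (h.d_mem i _ he) e (by omega)

lemma isWeightedHomogeneous_rename {k : Type*} [Field k] {σ τ : Type*} {w : σ → ℕ} {w' : τ → ℕ}
    {f : σ → τ} {c n : ℕ} (hw : ∀ i, w' (f i) = c * w i) {p : MvPolynomial σ k}
    (hp : IsWeightedHomogeneous w p n) : IsWeightedHomogeneous w' (rename f p) (c * n) := by
  intro d hd
  obtain ⟨u, rfl, hu⟩ := coeff_rename_ne_zero f p d hd
  rw [← hp hu]
  have : w' ∘ f = LinearMap.mulLeft ℕ c ∘ w := funext hw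
  change Finsupp.linearCombination ℕ w' _ = c * Finsupp.linearCombination ℕ w u
  rw [Finsupp.linearCombination_mapDomain, this]
  exact (Finsupp.apply_linearCombination ℕ (LinearMap.mulLeft ℕ c) w u).symm

lemma rename_mem_span_range_X {k : Type*} [Field k] {σ τ : Type*} (f : σ → τ)
    {p : MvPolynomial σ k} (hp : p ∈ Ideal.span (Set.range (X : σ → MvPolynomial σ k))) :
    rename f p ∈ Ideal.span (Set.range (X : τ → MvPolynomial τ k)) := by
  suffices Ideal.span (Set.range (X : σ → MvPolynomial σ k)) ≤
      (Ideal.span (Set.range (X : τ → MvPolynomial τ k))).comap (rename f) from this hp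
  rw [Ideal.span_le]
  rintro _ ⟨i, rfl⟩
  exact Ideal.subset_span ⟨f i, (rename_X f i).symm⟩

/-! ### The tensor product as a minimal graded resolution. -/

namespace tensorData

variable {k : Type*} [Field k] {ι κ : Type*} {k₁ k₂ : ℕ} {FA : DGData (MvPolynomial ι k)}
  {FB : DGData (MvPolynomial κ k)} {wA : ι → ℕ} {wB : κ → ℕ} {I : Ideal (MvPolynomial ι k)}
  {J : Ideal (MvPolynomial κ k)}

lemma finite_rank (hA : IsMinimalDGResolution wA I FA) (hB : IsMinimalDGResolution wB J FB)
    (n : ℕ) : ((tensorData k₁ k₂ FA FB).hdeg ⁻¹' {n}).Finite := by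
  have hfin : (⋃ ij ∈ Finset.HasAntidiagonal.antidiagonal n,
      (FA.hdeg ⁻¹' {ij.1}) ×ˢ (FB.hdeg ⁻¹' {ij.2})).Finite :=
    (Finset.HasAntidiagonal.antidiagonal n).finite_toSet.biUnion fun ij _ =>
      (hA.finite_rank ij.1).prod (hB.finite_rank ij.2)
  refine (hfin.image fun e => pair k₁ k₂ FA FB e.1 e.2).subset fun e => ?_
  induction e using basis_cases with
  | h e e' =>
    intro he
    refine ⟨(e, e'), ?_, rfl⟩
    simp only [Set.mem_iUnion]
    exact ⟨(FA.hdeg e, FB.hdeg e'), Finset.HasAntidiagonal.mem_antidiagonal.2 he, rfl, rfl⟩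

lemma hdeg_eq_zero_iff (hA : IsMinimalDGResolution wA I FA)
    (hB : IsMinimalDGResolution wB J FB) (e : (tensorData k₁ k₂ FA FB).basis) :
    (tensorData k₁ k₂ FA FB).hdeg e = 0 ↔ e = (tensorData k₁ k₂ FA FB).one := by
  induction e using basis_cases with
  | h e e' =>
    rw [hdeg_pair, one_eq, pair_inj, Nat.add_eq_zero_iff, hA.hdeg_eq_zero_iff,
      hB.hdeg_eq_zero_iff]

lemma d_mem (hA : IsMinimalDGResolution wA I FA) (hB : IsMinimalDGResolution wB J FB) {n : ℕ}
    {x : (tensorData k₁ k₂ FA FB).basis →₀ MvPolynomial (ι ⊕ κ) k}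
    (hx : x ∈ (tensorData k₁ k₂ FA FB).piece (n + 1)) :
    (tensorData k₁ k₂ FA FB).d x ∈ (tensorData k₁ k₂ FA FB).piece n := by
  refine piece_induction k₁ k₂ (P := fun x => (tensorData k₁ k₂ FA FB).d x ∈
    (tensorData k₁ k₂ FA FB).piece n) hx (fun x y hx hy => ?_) fun i j hij u hu v hv => ?_
  · rw [map_add]
    exact add_mem hx hy
  · rw [d_tm]
    refine add_mem ?_ ?_
    · cases i with
      | zero => simp [hA.d_zero u hu]
      | succ i =>
        obtain rfl : i + j = n := by omega
        exact tm_mem _ _ (hA.d_mem i u hu) hv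
    · cases j with
      | zero => simp [hB.d_zero v hv]
      | succ j =>
        obtain rfl : i + j = n := by omega
        exact tm_mem _ _ (FA.sgn_mem hu) (hB.d_mem j v hv)

lemma d_zero (hA : IsMinimalDGResolution wA I FA) (hB : IsMinimalDGResolution wB J FB)
    {x : (tensorData k₁ k₂ FA FB).basis →₀ MvPolynomial (ι ⊕ κ) k}
    (hx : x ∈ (tensorData k₁ k₂ FA FB).piece 0) : (tensorData k₁ k₂ FA FB).d x = 0 := by
  refine piece_induction k₁ k₂ (P := fun x => (tensorData k₁ k₂ FA FB).d x = 0) hx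
    (fun x y hx hy => ?_) fun i j hij u hu v hv => ?_
  · rw [map_add, hx, hy, add_zero]
  · obtain ⟨rfl, rfl⟩ : i = 0 ∧ j = 0 := by omega
    simp [d_tm, hA.d_zero u hu, hB.d_zero v hv]

lemma d_d (hA : IsMinimalDGResolution wA I FA) (hB : IsMinimalDGResolution wB J FB)
    (x : (tensorData k₁ k₂ FA FB).basis →₀ MvPolynomial (ι ⊕ κ) k) :
    (tensorData k₁ k₂ FA FB).d ((tensorData k₁ k₂ FA FB).d x) = 0 := by
  induction x using tensorData.induction with
  | add x y hx hy => rw [map_add, map_add, hx, hy, add_zero]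
  | tm u v => simp [d_tm, hA.d_d, hB.d_d, hA.sgn_d]

lemma d_homogeneous (hA : IsMinimalDGResolution wA I FA) (hB : IsMinimalDGResolution wB J FB)
    {w : ι ⊕ κ → ℕ} (hwA : ∀ i, w (Sum.inl i) = k₁ * wA i) (hwB : ∀ j, w (Sum.inr j) = k₂ * wB j)
    (e f : (tensorData k₁ k₂ FA FB).basis) :
    (tensorData k₁ k₂ FA FB).d (Finsupp.single e 1) f = 0 ∨
    ∃ n, (tensorData k₁ k₂ FA FB).wdeg e = n + (tensorData k₁ k₂ FA FB).wdeg f ∧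
      IsWeightedHomogeneous w ((tensorData k₁ k₂ FA FB).d (Finsupp.single e 1) f) n := by
  induction e using basis_cases with
  | h e e' =>
  induction f using basis_cases with
  | h f f' =>
  simp only [d_pair, wdeg_pair, Finsupp.add_apply, Finsupp.smul_apply, tm_apply, smul_eq_mul]
  -- The first summand of `∂(e ⊗ e')` meets only coordinates with `f' = e'`, the second only those
  -- with `f = e`. At `(e, e')` both vanish for degree reasons, so each coordinate comes from a
  -- single summand and is homogeneous.
  by_cases hf : f = e
  · subst hf
    rw [hA.d_single_self, map_zero, zero_mul, zero_add, Finsupp.single_eq_same, map_one, one_mul]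
    rcases hB.d_homogeneous e' f' with h0 | ⟨n, hn, hn'⟩
    · left
      rw [h0, map_zero, mul_zero]
    · refine Or.inr ⟨k₂ * n, by rw [hn]; ring, ?_⟩
      have : IsWeightedHomogeneous w ((-1 : MvPolynomial (ι ⊕ κ) k) ^ FA.hdeg f) 0 := by
        simpa using (isWeightedHomogeneous_C w ((-1 : k) ^ FA.hdeg f))
      simpa using this.mul (isWeightedHomogeneous_rename hwB hn')
  · rw [Finsupp.single_eq_of_ne hf, map_zero, zero_mul, mul_zero, add_zero]
    by_cases hf' : f' = e'
    · subst hf'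
      rw [Finsupp.single_eq_same, map_one, mul_one]
      rcases hA.d_homogeneous e f with h0 | ⟨n, hn, hn'⟩
      · left
        rw [h0, map_zero]
      · exact Or.inr ⟨k₁ * n, by rw [hn]; ring, isWeightedHomogeneous_rename hwA hn'⟩
    · left
      rw [Finsupp.single_eq_of_ne hf', map_zero, mul_zero]

lemma exact_zero (hA : IsMinimalDGResolution wA I FA) (hB : IsMinimalDGResolution wB J FB)
    (r : MvPolynomial (ι ⊕ κ) k) :
    r ∈ I.map (rename Sum.inl) ⊔ J.map (rename Sum.inr) ↔
      ∃ x ∈ (tensorData k₁ k₂ FA FB).piece 1, (tensorData k₁ k₂ FA FB).d x =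
        Finsupp.single (tensorData k₁ k₂ FA FB).one r := by
  constructor
  · suffices I.map (rename Sum.inl) ⊔ J.map (rename Sum.inr) ≤
        (((tensorData k₁ k₂ FA FB).piece 1).map (tensorData k₁ k₂ FA FB).d).comap
          (Finsupp.lsingle (tensorData k₁ k₂ FA FB).one) from fun hr => this hr
    refine sup_le (Ideal.map_le_iff_le_comap.2 fun f hf => ?_)
      (Ideal.map_le_iff_le_comap.2 fun f hf => ?_)
    · obtain ⟨x, hx, hdx⟩ := (hA.exact_zero f).1 hf
      refine ⟨tm k₁ k₂ FA FB x (Finsupp.single FB.one 1), tm_mem _ _ hx (hB.one_mem 1), ?_⟩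
      rw [d_tm, hdx, hB.d_zero _ (hB.one_mem 1), map_zero, add_zero, tm_single, map_one, mul_one]
      rfl
    · obtain ⟨x, hx, hdx⟩ := (hB.exact_zero f).1 hf
      refine ⟨tm k₁ k₂ FA FB (Finsupp.single FA.one 1) x, tm_mem _ _ (hA.one_mem 1) hx, ?_⟩
      rw [d_tm, hdx, hA.d_zero _ (hA.one_mem 1), map_zero, LinearMap.zero_apply, zero_add,
        DGData.sgn_of_mem (hA.one_mem 1), pow_zero, one_smul, tm_single, map_one, one_mul]
      rfl
  · rintro ⟨x, hx, hdx⟩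
    have key : (tensorData k₁ k₂ FA FB).d x (tensorData k₁ k₂ FA FB).one ∈
        I.map (rename (R := k) (Sum.inl : ι → ι ⊕ κ)) ⊔ J.map (rename Sum.inr) := by
      refine piece_induction k₁ k₂ (P := fun x => (tensorData k₁ k₂ FA FB).d x
        (tensorData k₁ k₂ FA FB).one ∈ I.map (rename (R := k) (Sum.inl : ι → ι ⊕ κ)) ⊔
          J.map (rename Sum.inr)) hx (fun x y hx hy => ?_) fun i j hij u hu v hv => ?_
      · rw [map_add]
        exact add_mem hx hy
      · rw [d_tm, one_eq, Finsupp.add_apply, tm_apply, tm_apply]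
        rcases i with _ | i
        · obtain rfl : j = 1 := by omega
          rw [hA.d_zero u hu, Finsupp.zero_apply, map_zero, zero_mul, zero_add]
          exact Ideal.mul_mem_left _ _ (Ideal.mem_sup_right (Ideal.mem_map_of_mem _
            ((hB.exact_zero _).2 ⟨v, hv, hB.eq_single_of_mem (hB.d_mem 0 v hv)⟩)))
        · obtain ⟨rfl, rfl⟩ : i = 0 ∧ j = 0 := by omega
          rw [hB.d_zero v hv, Finsupp.zero_apply, map_zero, mul_zero, add_zero]
          exact Ideal.mul_mem_right _ _ (Ideal.mem_sup_left (Ideal.mem_map_of_mem _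
            ((hA.exact_zero _).2 ⟨u, hu, hA.eq_single_of_mem (hA.d_mem 0 u hu)⟩)))
    rwa [hdx, Finsupp.single_eq_same] at key

/-- Künneth over `k`: with contractions `(s, p)` and `(t, q)` of the factors, `H = s ⊗ 1 + p ⊗ t`
satisfies `∂H + H∂ = 1 - p ⊗ q`, and `p ⊗ q` vanishes in positive total degree. A `k`-linear
homotopy is enough, since exactness concerns only the underlying vector spaces. -/
lemma exact_succ (hA : IsMinimalDGResolution wA I FA) (hB : IsMinimalDGResolution wB J FB) {n : ℕ}
    {x : (tensorData k₁ k₂ FA FB).basis →₀ MvPolynomial (ι ⊕ κ) k}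
    (hx : x ∈ (tensorData k₁ k₂ FA FB).piece (n + 1)) (hdx : (tensorData k₁ k₂ FA FB).d x = 0) :
    ∃ y ∈ (tensorData k₁ k₂ FA FB).piece (n + 2), (tensorData k₁ k₂ FA FB).d y = x := by
  obtain ⟨s, p, hs⟩ := hA.exists_isContraction
  obtain ⟨t, q, ht⟩ := hB.exists_isContraction
  let H : ((tensorData k₁ k₂ FA FB).basis →₀ MvPolynomial (ι ⊕ κ) k) →ₗ[k]
      ((tensorData k₁ k₂ FA FB).basis →₀ MvPolynomial (ι ⊕ κ) k) :=
    (equiv k₁ k₂ FA FB).toLinearMap ∘ₗ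
      (TensorProduct.map s LinearMap.id + TensorProduct.map p t) ∘ₗ
      (equiv k₁ k₂ FA FB).symm.toLinearMap
  have hH : ∀ u v, H (tm k₁ k₂ FA FB u v) =
      tm k₁ k₂ FA FB (s u) v + tm k₁ k₂ FA FB (p u) (t v) := fun u v => by
    simp [H, tm]
  have hH_mem : H x ∈ (tensorData k₁ k₂ FA FB).piece (n + 2) := by
    refine piece_induction k₁ k₂ (P := fun x => H x ∈ (tensorData k₁ k₂ FA FB).piece (n + 2)) hx
      (fun x y hx hy => ?_) fun i j hij u hu v hv => ?_
    · rw [map_add]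
      exact add_mem hx hy
    · rw [hH]
      refine add_mem ?_ ?_
      · obtain rfl : i = n + 1 - j := by omega
        convert tm_mem k₁ k₂ (hs.s_mem _ u hu) hv using 2
        omega
      · cases i with
        | zero =>
          convert tm_mem k₁ k₂ (hs.p_zero u hu) (ht.s_mem _ v hv) using 2
          omega
        | succ i => simp [hs.p_succ i u hu]
  have hHd : (tensorData k₁ k₂ FA FB).d (H x) + H ((tensorData k₁ k₂ FA FB).d x) = x := by
    refine piece_induction k₁ k₂ (P := fun x => (tensorData k₁ k₂ FA FB).d (H x) +
      H ((tensorData k₁ k₂ FA FB).d x) = x) hx (fun x y hx hy => ?_) fun i j hij u hu v hv => ?_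
    · rw [map_add, map_add, map_add, map_add, add_add_add_comm, hx, hy]
    · have hpq : tm k₁ k₂ FA FB (p u) (q v) = 0 := by
        cases i with
        | zero =>
          obtain rfl : j = n + 1 := by omega
          rw [ht.p_succ n v hv, map_zero]
        | succ i => rw [hs.p_succ i u hu, map_zero, LinearMap.zero_apply]
      have h₁ := LinearMap.congr_fun (congrArg (tm k₁ k₂ FA FB) (hs.d_s_add_s_d u)) v
      have h₂ := congrArg (tm k₁ k₂ FA FB (p u)) (ht.d_s_add_s_d v)
      rw [map_add, map_sub, LinearMap.add_apply, LinearMap.sub_apply] at h₁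
      rw [map_add, map_sub, hpq, sub_zero] at h₂
      -- Split `u ⊗ v` as `(u - p u) ⊗ v + p u ⊗ v`: the contraction of `F_A` rewrites the first
      -- term, that of `F_B` the second. The mixed terms `s u ⊗ ∂v` cancel because `s` anticommutes
      -- with `sgn`.
      rw [hH, map_add, d_tm, d_tm, d_tm, map_add, hH, hH, hs.sgn_s, hs.sgn_p, hs.p_sgn, hs.p_d,
        hs.d_p, map_neg, map_zero, LinearMap.neg_apply, LinearMap.zero_apply,
        ← sub_add_cancel (tm k₁ k₂ FA FB u v) (tm k₁ k₂ FA FB (p u) v),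
        ← h₁, ← h₂]
      abel
  exact ⟨H x, hH_mem, by rwa [hdx, map_zero, add_zero] at hHd⟩

lemma minimal (hA : IsMinimalDGResolution wA I FA) (hB : IsMinimalDGResolution wB J FB) :
    LinearMap.range (tensorData k₁ k₂ FA FB).d ≤
      Ideal.span (Set.range (X : ι ⊕ κ → MvPolynomial (ι ⊕ κ) k)) • ⊤ := by
  rintro _ ⟨x, rfl⟩
  induction x using tensorData.induction with
  | add x y hx hy =>
    rw [map_add]
    exact add_mem hx hy
  | tm u v =>
    rw [mem_ideal_smul_top_iff]
    intro e
    induction e using basis_cases with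
    | h e e' =>
      rw [d_tm, Finsupp.add_apply, tm_apply, tm_apply]
      exact add_mem
        (Ideal.mul_mem_right _ _ (rename_mem_span_range_X _
          (mem_ideal_smul_top_iff.1 (hA.minimal ⟨u, rfl⟩) e)))
        (Ideal.mul_mem_left _ _ (rename_mem_span_range_X _
          (mem_ideal_smul_top_iff.1 (hB.minimal ⟨v, rfl⟩) e')))

end tensorData

/-! ### The product on the tensor product. -/

namespace tensorData

variable {k : Type*} [Field k] {ι κ : Type*} {k₁ k₂ : ℕ} {FA : DGData (MvPolynomial ι k)}
  {FB : DGData (MvPolynomial κ k)} {wA : ι → ℕ} {wB : κ → ℕ} {I : Ideal (MvPolynomial ι k)}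
  {J : Ideal (MvPolynomial κ k)}

lemma bihomogeneous_induction
    {P : ((tensorData k₁ k₂ FA FB).basis →₀ MvPolynomial (ι ⊕ κ) k) → Prop}
    (x : (tensorData k₁ k₂ FA FB).basis →₀ MvPolynomial (ι ⊕ κ) k)
    (add : ∀ x y, P x → P y → P (x + y))
    (tm : ∀ i j, ∀ u ∈ FA.piece i, ∀ v ∈ FB.piece j, P (tm k₁ k₂ FA FB u v)) : P x :=
  DGData.piece_induction _ x add fun _ _ hx =>
    piece_induction k₁ k₂ hx add fun i j _ u hu v hv => tm i j u hu v hv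

lemma mul_mem (hA : IsMinimalDGResolution wA I FA) (hB : IsMinimalDGResolution wB J FB) {m n : ℕ}
    {x y : (tensorData k₁ k₂ FA FB).basis →₀ MvPolynomial (ι ⊕ κ) k}
    (hx : x ∈ (tensorData k₁ k₂ FA FB).piece m) (hy : y ∈ (tensorData k₁ k₂ FA FB).piece n) :
    (tensorData k₁ k₂ FA FB).mul x y ∈ (tensorData k₁ k₂ FA FB).piece (m + n) := by
  refine piece_induction k₁ k₂ (P := fun x => (tensorData k₁ k₂ FA FB).mul x y ∈
    (tensorData k₁ k₂ FA FB).piece (m + n)) hx (fun x x' hx hx' => ?_) fun i j hij u hu v hv => ?_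
  · rw [map_add, LinearMap.add_apply]
    exact add_mem hx hx'
  refine piece_induction k₁ k₂ (P := fun y => (tensorData k₁ k₂ FA FB).mul _ y ∈
    (tensorData k₁ k₂ FA FB).piece (m + n)) hy (fun y y' hy hy' => ?_)
    fun i' j' hij' u' hu' v' hv' => ?_
  · rw [map_add]
    exact add_mem hy hy'
  rw [mul_tm _ _ u hv hu' v', ← hij, ← hij', add_add_add_comm]
  exact Submodule.smul_mem _ _ (tm_mem _ _ (hA.mul_mem i i' u hu u' hu')
    (hB.mul_mem j j' v hv v' hv'))

lemma one_mul (hA : IsMinimalDGResolution wA I FA) (hB : IsMinimalDGResolution wB J FB)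
    (x : (tensorData k₁ k₂ FA FB).basis →₀ MvPolynomial (ι ⊕ κ) k) :
    (tensorData k₁ k₂ FA FB).mul (Finsupp.single (tensorData k₁ k₂ FA FB).one 1) x = x := by
  have hone : Finsupp.single (tensorData k₁ k₂ FA FB).one (1 : MvPolynomial (ι ⊕ κ) k) =
      tm k₁ k₂ FA FB (Finsupp.single FA.one 1) (Finsupp.single FB.one 1) := by
    rw [tm_single, map_one, map_one, _root_.mul_one, one_eq]
  rw [hone]
  induction x using bihomogeneous_induction with
  | add x y hx hy => rw [map_add, hx, hy]
  | tm i j u hu v hv =>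
    rw [mul_tm _ _ _ (hB.one_mem 1) hu, hA.one_mul, hB.one_mul, zero_mul, pow_zero, one_smul]

lemma mul_one (hA : IsMinimalDGResolution wA I FA) (hB : IsMinimalDGResolution wB J FB)
    (x : (tensorData k₁ k₂ FA FB).basis →₀ MvPolynomial (ι ⊕ κ) k) :
    (tensorData k₁ k₂ FA FB).mul x (Finsupp.single (tensorData k₁ k₂ FA FB).one 1) = x := by
  have hone : Finsupp.single (tensorData k₁ k₂ FA FB).one (1 : MvPolynomial (ι ⊕ κ) k) =
      tm k₁ k₂ FA FB (Finsupp.single FA.one 1) (Finsupp.single FB.one 1) := by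
    rw [tm_single, map_one, map_one, _root_.mul_one, one_eq]
  rw [hone]
  induction x using bihomogeneous_induction with
  | add x y hx hy => rw [map_add, LinearMap.add_apply, hx, hy]
  | tm i j u hu v hv =>
    rw [mul_tm _ _ _ hv (hA.one_mem 1), hA.mul_one, hB.mul_one, mul_zero, pow_zero, one_smul]

lemma mul_assoc (hA : IsMinimalDGResolution wA I FA) (hB : IsMinimalDGResolution wB J FB)
    (x y z : (tensorData k₁ k₂ FA FB).basis →₀ MvPolynomial (ι ⊕ κ) k) :
    (tensorData k₁ k₂ FA FB).mul ((tensorData k₁ k₂ FA FB).mul x y) z =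
      (tensorData k₁ k₂ FA FB).mul x ((tensorData k₁ k₂ FA FB).mul y z) := by
  induction x using bihomogeneous_induction with
  | add x x' hx hx' => simp only [map_add, LinearMap.add_apply, hx, hx']
  | tm i j u hu v hv =>
  induction y using bihomogeneous_induction with
  | add y y' hy hy' => simp only [map_add, LinearMap.add_apply, hy, hy']
  | tm i' j' u' hu' v' hv' =>
  induction z using bihomogeneous_induction with
  | add z z' hz hz' => simp only [map_add, hz, hz']
  | tm i'' j'' u'' hu'' v'' hv'' =>
    rw [mul_tm _ _ u hv hu', mul_tm _ _ u' hv' hu'', LinearMap.map_smul, LinearMap.map_smul,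
      LinearMap.smul_apply, mul_tm _ _ _ (hB.mul_mem j j' v hv v' hv') hu'',
      mul_tm _ _ u hv (hA.mul_mem i' i'' u' hu' u'' hu''), hA.mul_assoc, hB.mul_assoc, smul_smul,
      smul_smul, ← pow_add, ← pow_add]
    congr 2
    ring

lemma mul_comm (hA : IsMinimalDGResolution wA I FA) (hB : IsMinimalDGResolution wB J FB) {m n : ℕ}
    {x y : (tensorData k₁ k₂ FA FB).basis →₀ MvPolynomial (ι ⊕ κ) k}
    (hx : x ∈ (tensorData k₁ k₂ FA FB).piece m) (hy : y ∈ (tensorData k₁ k₂ FA FB).piece n) :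
    (tensorData k₁ k₂ FA FB).mul y x = (-1 : MvPolynomial (ι ⊕ κ) k) ^ (m * n) •
      (tensorData k₁ k₂ FA FB).mul x y := by
  refine piece_induction k₁ k₂ (P := fun x => (tensorData k₁ k₂ FA FB).mul y x =
    (-1 : MvPolynomial (ι ⊕ κ) k) ^ (m * n) • (tensorData k₁ k₂ FA FB).mul x y) hx
    (fun x x' hx hx' => ?_) fun i j hij u hu v hv => ?_
  · simp only [map_add, LinearMap.add_apply, smul_add, hx, hx']
  refine piece_induction k₁ k₂ (P := fun y => (tensorData k₁ k₂ FA FB).mul y _ =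
    (-1 : MvPolynomial (ι ⊕ κ) k) ^ (m * n) • (tensorData k₁ k₂ FA FB).mul _ y) hy
    (fun y y' hy hy' => ?_) fun i' j' hij' u' hu' v' hv' => ?_
  · simp only [map_add, LinearMap.add_apply, smul_add, hy, hy']
  rw [mul_tm _ _ u hv hu' v', mul_tm _ _ u' hv' hu v, hA.mul_comm i i' u hu u' hu',
    hB.mul_comm j j' v hv v' hv', tm_sign_left, tm_sign_right, smul_smul, smul_smul, smul_smul,
    ← pow_add, ← pow_add, ← pow_add, ← hij, ← hij']
  have : (i + j) * (i' + j') + j * i' = j' * i + (i * i' + j * j') + 2 * (j * i') := by ring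
  rw [this, pow_add _ _ (2 * _), pow_mul, neg_one_sq, one_pow, _root_.mul_one, add_assoc]

lemma leibniz (hA : IsMinimalDGResolution wA I FA) (hB : IsMinimalDGResolution wB J FB) {m n : ℕ}
    {x y : (tensorData k₁ k₂ FA FB).basis →₀ MvPolynomial (ι ⊕ κ) k}
    (hx : x ∈ (tensorData k₁ k₂ FA FB).piece m) (hy : y ∈ (tensorData k₁ k₂ FA FB).piece n) :
    (tensorData k₁ k₂ FA FB).d ((tensorData k₁ k₂ FA FB).mul x y) =
      (tensorData k₁ k₂ FA FB).mul ((tensorData k₁ k₂ FA FB).d x) y +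
        (-1 : MvPolynomial (ι ⊕ κ) k) ^ m •
          (tensorData k₁ k₂ FA FB).mul x ((tensorData k₁ k₂ FA FB).d y) := by
  refine piece_induction k₁ k₂ (P := fun x => (tensorData k₁ k₂ FA FB).d
    ((tensorData k₁ k₂ FA FB).mul x y) = (tensorData k₁ k₂ FA FB).mul
      ((tensorData k₁ k₂ FA FB).d x) y + (-1 : MvPolynomial (ι ⊕ κ) k) ^ m •
          (tensorData k₁ k₂ FA FB).mul x ((tensorData k₁ k₂ FA FB).d y)) hx
    (fun x x' hx hx' => ?_) fun i j hij u hu v hv => ?_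
  · simp only [map_add, LinearMap.add_apply, smul_add, hx, hx']
    abel
  refine piece_induction k₁ k₂ (P := fun y => (tensorData k₁ k₂ FA FB).d
    ((tensorData k₁ k₂ FA FB).mul _ y) = (tensorData k₁ k₂ FA FB).mul
      ((tensorData k₁ k₂ FA FB).d _) y + (-1 : MvPolynomial (ι ⊕ κ) k) ^ m •
          (tensorData k₁ k₂ FA FB).mul _ ((tensorData k₁ k₂ FA FB).d y)) hy
    (fun y y' hy hy' => ?_) fun i' j' hij' u' hu' v' hv' => ?_
  · simp only [map_add, smul_add, hy, hy']
    abel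
  -- The expected sign is `(-1) ^ ((j - 1) * i')`. Writing it as `(-1) ^ i' * (-1) ^ (j * i')`
  -- avoids the subtraction and also covers `j = 0`, where `∂v = 0`.
  have hdv : (tensorData k₁ k₂ FA FB).mul (tm k₁ k₂ FA FB u (FB.d v)) (tm k₁ k₂ FA FB u' v') =
      (-1 : MvPolynomial (ι ⊕ κ) k) ^ i' • (-1 : MvPolynomial (ι ⊕ κ) k) ^ (j * i') •
        tm k₁ k₂ FA FB (FA.mul u u') (FB.mul (FB.d v) v') := by
    cases j with
    | zero => simp [hB.d_zero v hv]
    | succ j =>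
      rw [mul_tm _ _ u (hB.d_mem j v hv) hu' v', add_one_mul, pow_add,
        _root_.mul_comm ((-1 : MvPolynomial (ι ⊕ κ) k) ^ (j * i')), mul_smul,
        neg_one_pow_smul_self]
  have hdu : (tensorData k₁ k₂ FA FB).mul (tm k₁ k₂ FA FB u v) (tm k₁ k₂ FA FB (FA.d u') v') =
      (-1 : MvPolynomial (ι ⊕ κ) k) ^ j • (-1 : MvPolynomial (ι ⊕ κ) k) ^ (j * i') •
        tm k₁ k₂ FA FB (FA.mul u (FA.d u')) (FB.mul v v') := by
    cases i' with
    | zero => simp [hA.d_zero u' hu']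
    | succ i' =>
      rw [mul_tm _ _ u hv (hA.d_mem i' u' hu') v', mul_add_one, pow_add,
        _root_.mul_comm ((-1 : MvPolynomial (ι ⊕ κ) k) ^ (j * i')), mul_smul,
        neg_one_pow_smul_self]
  have hj := neg_one_pow_smul_self (R := MvPolynomial (ι ⊕ κ) k) j
    ((-1 : MvPolynomial (ι ⊕ κ) k) ^ (j * i') •
        tm k₁ k₂ FA FB (FA.mul u (FA.d u')) (FB.mul v v'))
  rw [mul_tm _ _ u hv hu' v', LinearMap.map_smul, d_tm, d_tm, d_tm, map_add (tensorData _ _ _ _).mul,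
    LinearMap.add_apply, map_add ((tensorData _ _ _ _).mul _), mul_tm _ _ (FA.d u) hv hu' v',
    DGData.sgn_of_mem hu, DGData.sgn_of_mem hu', DGData.sgn_of_mem (hA.mul_mem i i' u hu u' hu'),
    hA.leibniz i i' u hu u' hu', hB.leibniz j j' v hv v' hv', map_add (tm _ _ _ _),
    LinearMap.add_apply, map_add (tm _ _ _ _ _), tm_sign_left, tm_sign_left, tm_sign_left,
    tm_sign_left, tm_sign_left, tm_sign_right, LinearMap.map_smul, LinearMap.map_smul,
    LinearMap.smul_apply, hdv, hdu, mul_tm _ _ u hv hu' (FB.d v'), ← hij, pow_add _ i j,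
    pow_add _ i i']
  simp only [smul_add, mul_smul, hj]
  clear hdv hdu hj
  -- All cancellations of squared signs have been carried out, so the remaining identity holds with
  -- arbitrary scalars in place of the signs.
  generalize (-1 : MvPolynomial (ι ⊕ κ) k) ^ i = ε₁, (-1 : MvPolynomial (ι ⊕ κ) k) ^ i' = ε₂,
    (-1 : MvPolynomial (ι ⊕ κ) k) ^ j = ε₃, (-1 : MvPolynomial (ι ⊕ κ) k) ^ (j * i') = ε₄
  module

theorem isMinimalDGResolution (hA : IsMinimalDGResolution wA I FA)
    (hB : IsMinimalDGResolution wB J FB) {w : ι ⊕ κ → ℕ}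
    (hwA : ∀ i, w (Sum.inl i) = k₁ * wA i) (hwB : ∀ j, w (Sum.inr j) = k₂ * wB j) :
    IsMinimalDGResolution w (I.map (rename Sum.inl) ⊔ J.map (rename Sum.inr))
      (tensorData k₁ k₂ FA FB) where
  finite_rank := finite_rank hA hB
  hdeg_eq_zero_iff := hdeg_eq_zero_iff hA hB
  wdeg_one := by rw [one_eq, wdeg_pair, hA.wdeg_one, hB.wdeg_one, mul_zero, mul_zero, add_zero]
  d_mem _ _ hx := d_mem hA hB hx
  d_zero _ hx := d_zero hA hB hx
  d_d := d_d hA hB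
  d_homogeneous := d_homogeneous hA hB hwA hwB
  exact_zero := exact_zero hA hB
  exact_succ _ _ hx hdx := exact_succ hA hB hx hdx
  minimal := minimal hA hB
  mul_mem _ _ _ hx _ hy := mul_mem hA hB hx hy
  one_mul := one_mul hA hB
  mul_one := mul_one hA hB
  mul_assoc := mul_assoc hA hB
  mul_comm _ _ _ hx _ hy := mul_comm hA hB hx hy
  leibniz _ _ _ hx _ hy := leibniz hA hB hx hy

end tensorData

lemma exists_sum_mul_eq {ι : Type*} [Fintype ι] {a : ι → ℕ} {n : ℕ}
    (h : n ∈ AddSubmonoid.closure (Set.range a)) : ∃ α : ι → ℕ, ∑ i, α i * a i = n := by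
  obtain ⟨α, rfl⟩ := AddSubmonoid.mem_closure_range_iff_of_fintype.1 h
  exact ⟨α, by simp⟩

end Gluing

end

/-! ### The theorem. -/

theorem proposition3p14 {k : Type*} [Field k] {ι κ : Type*} [Fintype ι] [Fintype κ]
    (a : ι → ℕ) (b : κ → ℕ) (k₁ k₂ : ℕ) (h : Gluing.IsGluing a b k₁ k₂) :
    (Gluing.HasMinimalDGResolution k a → Gluing.HasMinimalDGResolution k b →
      Gluing.HasMinimalDGResolution k (Gluing.gluedFamily a b k₁ k₂)) ∧
    ∀ (FA : Gluing.DGData (MvPolynomial ι k)) (FB : Gluing.DGData (MvPolynomial κ k)),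
      Gluing.IsMinimalDGResolution a (Gluing.semigroupIdeal k a) FA →
      Gluing.IsMinimalDGResolution b (Gluing.semigroupIdeal k b) FB →
      Gluing.IsMinimalDGResolution (Gluing.gluedFamily a b k₁ k₂)
        ((Gluing.semigroupIdeal k a).map (MvPolynomial.rename Sum.inl) ⊔
          (Gluing.semigroupIdeal k b).map (MvPolynomial.rename Sum.inr))
        (Gluing.tensorData k₁ k₂ FA FB) ∧
      ∀ (α : ι → ℕ) (β : κ → ℕ), ∑ i, α i * a i = k₂ → ∑ j, β j * b j = k₁ →
        Gluing.IsMinimalDGResolution (Gluing.gluedFamily a b k₁ k₂)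
          (Gluing.semigroupIdeal k (Gluing.gluedFamily a b k₁ k₂))
          (Gluing.coneData (Gluing.rho k α β) (k₁ * k₂)
            (Gluing.tensorData k₁ k₂ FA FB)) := by
  have tensor := fun (FA : Gluing.DGData (MvPolynomial ι k))
    (FB : Gluing.DGData (MvPolynomial κ k))
    (hA : Gluing.IsMinimalDGResolution a (Gluing.semigroupIdeal k a) FA)
    (hB : Gluing.IsMinimalDGResolution b (Gluing.semigroupIdeal k b) FB) =>
    Gluing.tensorData.isMinimalDGResolution (k₁ := k₁) (k₂ := k₂) hA hB
      (w := Gluing.gluedFamily a b k₁ k₂) (fun _ => rfl) (fun _ => rfl)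
  -- The cone resolves the quotient by `I_A R + I_B R + (ρ)`; the result is transported along the
  -- equality of this ideal with `I_C`.
  have cone := fun FA FB hA hB (α : ι → ℕ) (β : κ → ℕ) (hα : ∑ i, α i * a i = k₂)
      (hβ : ∑ j, β j * b j = k₁) =>
    (Gluing.semigroupIdeal_gluedFamily (k := k) h.pos₂ h.coprime hα hβ).symm ▸
      Gluing.coneData.isMinimalDGResolution (tensor FA FB hA hB)
        (Gluing.isWeightedHomogeneous_rho hα hβ) (Gluing.rho_mem h.pos₁ h.pos₂ hα hβ)
        fun _ => Gluing.mem_sumIdeal_of_rho_mul_mem hα h.pos₂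
  refine ⟨?_, fun FA FB hA hB => ⟨tensor FA FB hA hB, cone FA FB hA hB⟩⟩
  rintro ⟨FA, hA⟩ ⟨FB, hB⟩
  obtain ⟨α, hα⟩ := Gluing.exists_sum_mul_eq h.mem₂
  obtain ⟨β, hβ⟩ := Gluing.exists_sum_mul_eq h.mem₁
  exact ⟨_, cone FA FB hA hB α β hα hβ⟩
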